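/- **Setting.** A finite-arm instance consists of finitely many arms, $j=1,\dots,n$, partitioned into a finite nonempty collection $\mathcal H$ of nonempty disjoint groups $H$. Arm $j$ has mean reward $\mu_j\in[0,1]$, and its reward law is sub-Gaussian with parameter $\sigma^2\le 1$, i.e. $\mathbb E[X]=\mu_j$ and $\mathbb E[e^{\lambda(X-\mu_j)}]\le e^{\lambda^2/2}$ for all $\lambda\in\mathbb R$; the rewards $X_{j,1},X_{j,2},\dots$ of each arm (indexed by the round in which it is pulled) are i.i.d. For a finite multiset $V$ of reals let $Q_{p}(V)=\inf\{x: |\{v\in V: v\le x\}|/|V|\ge p\}$, and for a group put $F_H^{-1}(1-\alpha)=Q_{1-\alpha}(\{\mu_j\}_{j\in H})$. Let $H^*$ be any maximizer of $F_H^{-1}(1-\alpha)$ over $H\in\mathcal H$, $\Delta_H=F_{H^*}^{-1}(1-\alpha)-F_H^{-1}(1-\alpha)$, $\Delta_0=\min_{H\ne H^*}\Delta_H$ ($\Delta_0=0$ if there is only one group), and for an arm $j\in H$ $$\Delta_j=\max\{\Delta,\ \Delta_H,\ \Delta_0,\ |\mu_j-F_H^{-1}(1-\alpha)|\}.$$ **Algorithm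 (successive elimination)** with input $(\mathcal H,\alpha,\Delta,\delta)$. Let $$U(T,\eta)=\sqrt{\frac{2\log(1/\eta)+6\log\log(1/\eta)+3\log\log(eT)}{T}},\qquad \eta=\min\{\delta/n,\,1/10\}.$$ Start with $\mathcal C_1=\mathcal H$, $m_1^{(H)}=H$, $\Delta^{(1)}=\infty$. While $|\mathcal C_t|>1$ and $\Delta^{(t)}>\Delta$, in round $t$ pull once every arm of $\mathcal B_t=\bigcup_{H\in\mathcal C_t}m_t^{(H)}$; for each arm let $T_j(t)$ be its number of pulls so far, $\hat\mu_j(t)$ its empirical mean so far, and $\mathrm{LCB}_t(j),\mathrm{UCB}_t(j)=\hat\mu_j(t)\mp U(T_j(t),\eta)$. Write $L_t(H)=Q_{1-\alpha}(\{\mathrm{LCB}_t(j)\}_{j\in H})$ and $R_t(H)=Q_{1-\alpha}(\{\mathrm{UCB}_t(j)\}_{j\in H})$, and set $$\mathcal C_{t+1}=\{H\in\mathcal C_t: R_t(H)\ge L_t(H')\ \forall H'\in\mathcal C_t\},$$ $$m_{t+1}^{(H)}=\{j\in m_t^{(H)}: \mathrm{LCB}_t(j)\le R_t(H)\ \text{and}\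 \mathrm{UCB}_t(j)\ge L_t(H)\},$$ $$\Delta^{(t+1)}=\max_{H\in\mathcal C_{t+1}}R_t(H)-\max_{H\in\mathcal C_{t+1}}L_t(H).$$ When the loop is left, return some $\hat H\in\arg\max_{H\in\mathcal C_t}L_{t-1}(H)$, ties being broken in any way (if the loop is left before the first round, there is only one group, and it is returned). **Theorem.** There are universal constants $c,d>0$ such that the following hold. (1) *Finite arms.* For every finite-arm instance and all $\alpha,\Delta,\delta\in(0,1)$, with probability at least $1-\delta$ the algorithm terminates, the returned group satisfies $$F_{\hat H}^{-1}(1-\alpha)\ge\max_{H\in\mathcal H}F_H^{-1}(1-\alpha)-\Delta ,$$ and the total number $T$ of arm pulls satisfies $$T\le\sum_{j=1}^n\frac{c}{\Delta_j^2}\log\Big(\frac n\delta\log\frac{e}{\Delta_j^2}\Big).$$ (2) *Sampled groups.* Let $\mathcal G$ be a finite nonempty set of groups, let each $G\in\mathcal G$ have a reservoir distribution $F_G$ of mean rewards on $[0,1]$, and let the reward laws come from a (measurable) family parametrized by the mean and satisfying the sub-Gaussian condition above. Let $\alpha,\Delta\in(0,1)$ and $0<\delta<\epsilon<\min(\alpha,1-\alpha)$.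 Draw independently, for each $G$, $N=\lceil\frac1{2\epsilon^2}\log\frac{2|\mathcal G|}{\delta}\rceil$ arms with means distributed as $F_G$, forming a finite group $H$; given the means, all rewards are independent, each with the law of its arm. Run the algorithm with input $(\mathcal H,\alpha,\Delta,\delta)$ on the resulting random collection $\mathcal H$ (so $|\mathcal H|=|\mathcal G|$ and $n=N|\mathcal G|$). With probability at least $1-\delta$ it terminates, the returned group satisfies $F_{\hat H}^{-1}(1-\alpha)\ge\max_{H\in\mathcal H}F_H^{-1}(1-\alpha)-\Delta$, and $$T\le\sum_{j=1}^{n}\frac{c}{\Delta_j^2}\log\Big(\frac{|\mathcal H|N}\delta\log\frac{e}{\Delta_j^2}\Big)\le d\,\frac{|\mathcal G|}{\epsilon^2\Delta^2}\Big(\log^2\frac{|\mathcal G|}\delta+\log\frac{|\mathcal G|}\delta\cdot\log\log\frac e\Delta\Big).$$ -/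

import Mathlib

open MeasureTheory ProbabilityTheory

universe u v w

namespace GroupedBandit

noncomputable section

/-! ### Reward distributions -/

/-- `ν` is an admissible reward distribution of an arm with mean reward `m`: the mean `m` lies in
`[0,1]` and is the expectation of `ν`, and `ν` is sub-Gaussian with parameter `σ² ≤ 1`
(integrability is part of `HasSubgaussianMGF`). -/
structure IsRewardLaw (ν : Measure ℝ) (m : ℝ) : Prop where
  mean_mem : m ∈ Set.Icc (0 : ℝ) 1
  mean_eq : ∫ x, x ∂ν = m
  subgaussian : HasSubgaussianMGF (fun x => x - m) 1 ν

/-- For a family `κ` of reward distributions parametrized by the mean, and arms `A` with means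
`m j`: the joint law of the rewards `X (j, t)` (arm `j`, round `t`) given the means; they are
independent, and `X (j, t)` has law `κ (m j)`. -/
def rewardKernel {A : Type*} (κ : Kernel ℝ ℝ) [IsMarkovKernel κ] :
    Kernel (A → ℝ) (A × ℕ → ℝ) where
  toFun m := Measure.infinitePi (fun p : A × ℕ => κ (m p.1))
  measurable' := by
    refine Measurable.measure_of_isPiSystem_of_isProbabilityMeasure
      generateFrom_squareCylinders.symm
      (isPiSystem_squareCylinders (fun _ => MeasurableSpace.isPiSystem_measurableSet)
        (fun _ => by simp)) ?_
    rintro S ⟨s, t, ht, rfl⟩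
    have ht' : ∀ i, MeasurableSet (t i) := fun i => ht i (Set.mem_univ i)
    have h : (fun m : A → ℝ => Measure.infinitePi (fun p : A × ℕ => κ (m p.1)) ((s : Set _).pi t))
        = fun m => ∏ p ∈ s, κ (m p.1) (t p) := by
      funext m
      exact Measure.infinitePi_pi _ (fun i _ => ht' i)
    rw [h]
    exact Finset.measurable_prod _
      (fun p _ => (κ.measurable_coe (ht' p)).comp (measurable_pi_apply p.1))

instance {A : Type*} (κ : Kernel ℝ ℝ) [IsMarkovKernel κ] :
    IsMarkovKernel (rewardKernel (A := A) κ) where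
  isProbabilityMeasure m :=
    inferInstanceAs (IsProbabilityMeasure (Measure.infinitePi (fun p : A × ℕ => κ (m p.1))))

/-- The joint law of (means, rewards) when the mean of each arm `j` is drawn independently from
`ρ j` and, given the means, the rewards are drawn independently from the family `κ`. -/
def armLaw {A : Type*} [Fintype A] (ρ : A → Measure ℝ) (κ : Kernel ℝ ℝ) [IsMarkovKernel κ] :
    Measure ((A → ℝ) × (A × ℕ → ℝ)) :=
  Measure.pi ρ ⊗ₘ rewardKernel κ

/-- Number of arms requested from each group: `N = ⌈(1 / (2ε²)) log (2|𝒢| / δ)⌉`. -/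
def numArms (numGroups : ℕ) (ε δ : ℝ) : ℕ :=
  ⌈1 / (2 * ε ^ 2) * Real.log (2 * numGroups / δ)⌉₊

/-! ### Quantiles and gaps

The arms are the elements of a finite type `A`, the groups those of a finite type `H`, and
`grp : A → H` gives the group of each arm. -/

section Finite

variable {A H : Type*} [Fintype A] [Fintype H]

open Classical in
/-- The set of arms in group `h`. -/
def arms (grp : A → H) (h : H) : Finset A := Finset.univ.filter (fun j => grp j = h)

open Classical in
/-- The empirical CDF of the finite multiset `{v j : j ∈ S}`. -/
def empCDF (S : Finset A) (v : A → ℝ) (x : ℝ) : ℝ :=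
  ((S.filter (fun j => v j ≤ x)).card : ℝ) / S.card

/-- The `p`-quantile `inf {x : F x ≥ p}` of the finite multiset `{v j : j ∈ S}`. -/
def quantile (p : ℝ) (S : Finset A) (v : A → ℝ) : ℝ := sInf {x : ℝ | p ≤ empCDF S v x}

/-- The `(1 - α)`-quantile of the values `v` over the arms of group `h`. -/
def groupQuantile (grp : A → H) (α : ℝ) (v : A → ℝ) (h : H) : ℝ :=
  quantile (1 - α) (arms grp h) v

/-- `h` is a group with a highest `(1 - α)`-quantile, for the mean rewards `μ`. -/
def IsBest (grp : A → H) (α : ℝ) (μ : A → ℝ) (h : H) : Prop :=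
  ∀ h', groupQuantile grp α μ h' ≤ groupQuantile grp α μ h

/-- The `(1 - α)`-quantile of group `h` is within `Δ` of the best one. -/
def IsNearBest (grp : A → H) (α Δ : ℝ) (μ : A → ℝ) (h : H) : Prop :=
  ∀ h', groupQuantile grp α μ h' - Δ ≤ groupQuantile grp α μ h

/-- The gap `Δ_h` of group `h` relative to the best group `hs`. -/
def groupGap (grp : A → H) (α : ℝ) (μ : A → ℝ) (hs h : H) : ℝ :=
  groupQuantile grp α μ hs - groupQuantile grp α μ h

/-- The gap `Δ₀`, the minimum of `Δ_h` over `h ≠ hs` (and `0` if `hs` is the only group). -/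
def bestGap (grp : A → H) (α : ℝ) (μ : A → ℝ) (hs : H) : ℝ :=
  ⨅ h : {h : H // h ≠ hs}, groupGap grp α μ hs h

/-- The gap `Δ_j = max {Δ, Δ_h, Δ₀, |μ_j - F_h⁻¹(1 - α)|}` of arm `j`, where `h` is its group. -/
def armGap (grp : A → H) (α Δ : ℝ) (μ : A → ℝ) (hs : H) (j : A) : ℝ :=
  max (max Δ (groupGap grp α μ hs (grp j)))
    (max (bestGap grp α μ hs) |μ j - groupQuantile grp α μ (grp j)|)

/-- The instance-dependent bound `∑_j (c / Δ_j²) log ((n / δ) log (e / Δ_j²))`, with `n` the number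
of arms. -/
def pullBound (c : ℝ) (grp : A → H) (α Δ δ : ℝ) (μ : A → ℝ) (hs : H) : ℝ :=
  ∑ j, c / armGap grp α Δ μ hs j ^ 2 *
    Real.log (Fintype.card A / δ * Real.log (Real.exp 1 / armGap grp α Δ μ hs j ^ 2))

/-! ### The successive elimination algorithm -/

/-- `U(T, η) = √((2 log(1/η) + 6 log log(1/η) + 3 log log(eT)) / T)`. -/
def confWidth (T : ℕ) (η : ℝ) : ℝ :=
  √((2 * Real.log (1 / η) + 6 * Real.log (Real.log (1 / η))
    + 3 * Real.log (Real.log (Real.exp 1 * T))) / T)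

/-- The state of the algorithm at the beginning of a round `t`. -/
structure SEState (A H : Type*) where
  /-- the candidate groups `𝒞_t` -/
  cand : Finset H
  /-- the potential quantile arms `m_t` of each group -/
  pot : H → Finset A
  /-- the number of pulls `T_j(t-1)` of each arm in the previous rounds -/
  count : A → ℕ
  /-- the sum of the rewards observed from each arm in the previous rounds -/
  total : A → ℝ
  /-- the quantity `Δ^{(t)}` -/
  gap : EReal

/-- The empirical mean of arm `j` (from the pulls recorded in the state). -/
def SEState.mean (s : SEState A H) (j : A) : ℝ := s.total j / s.count j

/-- Half-width of the confidence interval of arm `j`: `U(T_j, δ/n)`, with the confidence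
parameter `δ/n` replaced by `1/10` if it is larger. -/
def SEState.width (δ : ℝ) (s : SEState A H) (j : A) : ℝ :=
  confWidth (s.count j) (min (δ / Fintype.card A) (1 / 10))

def SEState.lcb (δ : ℝ) (s : SEState A H) (j : A) : ℝ := s.mean j - s.width δ j

def SEState.ucb (δ : ℝ) (s : SEState A H) (j : A) : ℝ := s.mean j + s.width δ j

/-- The active arms `ℬ_t`, those that are pulled in round `t`. -/
def SEState.IsActive (s : SEState A H) (j : A) : Prop := ∃ h ∈ s.cand, j ∈ s.pot h

/-- Total number of arm pulls in the previous rounds. -/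
def SEState.pulls (s : SEState A H) : ℕ := ∑ j, s.count j

/-- The initial state (`t = 1`). -/
def initState (grp : A → H) : SEState A H where
  cand := Finset.univ
  pot := arms grp
  count := fun _ => 0
  total := fun _ => 0
  gap := ⊤

open Classical in
/-- Pull every active arm once; `x j` is the reward of arm `j` in this round (it is used for active
arms only). -/
def SEState.pull (s : SEState A H) (x : A → ℝ) : SEState A H :=
  { s with
    count := fun j => if s.IsActive j then s.count j + 1 else s.count j
    total := fun j => if s.IsActive j then s.total j + x j else s.total j }

open Classical in
/-- Candidate groups kept after a round, from the confidence bounds of the updated state `s`. -/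
def SEState.newCand (grp : A → H) (α δ : ℝ) (s : SEState A H) : Finset H :=
  s.cand.filter (fun h =>
    ∀ h' ∈ s.cand, groupQuantile grp α (s.lcb δ) h' ≤ groupQuantile grp α (s.ucb δ) h)

open Classical in
/-- Potential quantile arms kept after a round (an eliminated arm does not come back). -/
def SEState.newPot (grp : A → H) (α δ : ℝ) (s : SEState A H) (h : H) : Finset A :=
  (s.pot h).filter (fun j =>
    s.lcb δ j ≤ groupQuantile grp α (s.ucb δ) h ∧ groupQuantile grp α (s.lcb δ) h ≤ s.ucb δ j)

/-- Difference of the largest upper and the largest lower confidence bound for the quantile, over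
the groups in the finite set `C`. -/
def SEState.spread (grp : A → H) (α δ : ℝ) (s : SEState A H) (C : Finset H) : ℝ :=
  sSup (groupQuantile grp α (s.ucb δ) '' C) - sSup (groupQuantile grp α (s.lcb δ) '' C)

/-- One round of the algorithm: pull the active arms, then eliminate. -/
def SEState.step (grp : A → H) (α δ : ℝ) (s : SEState A H) (x : A → ℝ) : SEState A H :=
  let s' := s.pull x
  { s' with
    cand := s'.newCand grp α δ
    pot := s'.newPot grp α δ
    gap := (s'.spread grp α δ (s'.newCand grp α δ) : ℝ) }

/-- The state after `k` rounds, where `x j t` is the reward of arm `j` in round `t + 1`. -/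
def seRun (grp : A → H) (α δ : ℝ) (x : A → ℕ → ℝ) : ℕ → SEState A H
  | 0 => initState grp
  | k + 1 => (seRun grp α δ x k).step grp α δ (fun j => x j k)

/-- The condition under which the while-loop of the algorithm is left. -/
def SEState.Stop (Δ : ℝ) (s : SEState A H) : Prop := s.cand.card ≤ 1 ∨ s.gap ≤ (Δ : EReal)

/-- The algorithm stops after exactly `k` rounds. -/
def StopsAt (grp : A → H) (α Δ δ : ℝ) (x : A → ℕ → ℝ) (k : ℕ) : Prop :=
  (seRun grp α δ x k).Stop Δ ∧ ∀ i < k, ¬ (seRun grp α δ x i).Stop Δ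

/-- `h` is a possible output at the final state `s`: a candidate group that maximizes the
`(1 - α)`-quantile of the lower confidence bounds. -/
def SEState.IsOutput (grp : A → H) (α δ : ℝ) (s : SEState A H) (h : H) : Prop :=
  h ∈ s.cand ∧
    ∀ h' ∈ s.cand, groupQuantile grp α (s.lcb δ) h' ≤ groupQuantile grp α (s.lcb δ) h

/-- With the rewards `x` and the parameters `α, Δ, δ`, the algorithm stops, its output is within `Δ`
of the best group for the means `μ` however ties are broken, and its total number of pulls
satisfies `B`. -/
def SESucceeds (grp : A → H) (α Δ δ : ℝ) (μ : A → ℝ) (x : A → ℕ → ℝ) (B : ℕ → Prop) : Prop :=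
  ∃ k, StopsAt grp α Δ δ x k ∧
    (∀ h, (seRun grp α δ x k).IsOutput grp α δ h → IsNearBest grp α Δ μ h) ∧
    B (seRun grp α δ x k).pulls

end Finite

end

end GroupedBandit

/-! All the randomness is confined to one event: for every arm and every number of pulls `T`, the
empirical mean is within `confWidth T η` of the true mean (`AllConcentrate`). On this event
everything is deterministic (`AllConcentrate.seSucceeds`).

The event fails with probability at most `n * η ≤ δ`. For one arm, Ville's inequality
(`measure_exists_le_prod_le`) keeps the centered sums below any fixed line. Cutting the times into
geometric slices and using one line per slice turns lines into the curved boundary `√(T log log T)`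
(`measure_exists_sqrt_lt_sum_le`). Each arm is pulled in an initial segment of the rounds, so the
bound, uniform in `T`, applies to whatever count the algorithm produces.

On the event, group quantiles of LCB and UCB bracket the true quantile. The key point is that
eliminated arms, whose intervals are frozen and may be wide, do no harm: such an interval misses the
quantile, so it stays on the correct side of it. Hence the bracket of a candidate group is within
`2U` of the true quantile on each side, where `U` is the current width (`quantile_ucb_le`,
`le_quantile_lcb`). Therefore a best group survives, and an arm still active while the loop runs has
gap at most `4U` (`AllConcentrate.armGap_le`). Inverting `U` (`succ_le_of_le_confWidth`) bounds the
pulls of each arm.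

For sampled groups the same argument is applied conditionally on the means; then each gap is bounded
below by `Δ` and `N` is inserted (`pullBound_sampled_le`). -/

namespace GroupedBandit

open scoped ENNReal

/-! ### A maximal inequality for products of independent variables -/

section Maximal

variable {Ω : Type*}

/-- The product of the first `n` variables, frozen from the first time it reaches level `c`. -/
noncomputable def stoppedProd (Y : ℕ → Ω → ℝ≥0∞) (c : ℝ≥0∞) : ℕ → Ω → ℝ≥0∞
  | 0 => fun _ => 1
  | n + 1 => fun ω =>
      if c ≤ stoppedProd Y c n ω then stoppedProd Y c n ω else stoppedProd Y c n ω * Y n ω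

/-- Freezing starts only at level `c`, so a crossing by the raw product at any time forces the
frozen one to be above `c` as well. -/
lemma stoppedProd_eq_prod_or_le (Y : ℕ → Ω → ℝ≥0∞) (c : ℝ≥0∞) (n : ℕ) (ω : Ω) :
    stoppedProd Y c n ω = ∏ i ∈ Finset.range n, Y i ω ∨ c ≤ stoppedProd Y c n ω := by
  induction n with
  | zero => simp [stoppedProd]
  | succ n ih =>
    by_cases h : c ≤ stoppedProd Y c n ω
    · right; simp [stoppedProd, h]
    · left
      rcases ih with ih | ih
      · rw [Finset.prod_range_succ, ← ih]
        simp only [stoppedProd, h, if_false]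
      · exact absurd ih h

/-- The σ-algebra generated by the first `n` variables. -/
@[reducible] def sigmaBefore (Y : ℕ → Ω → ℝ≥0∞) (n : ℕ) : MeasurableSpace Ω :=
  ⨆ i ∈ Set.Iio n, MeasurableSpace.comap (Y i) inferInstance

lemma measurable_stoppedProd_sigmaBefore (Y : ℕ → Ω → ℝ≥0∞) (c : ℝ≥0∞) (n : ℕ) :
    Measurable[sigmaBefore Y n] (stoppedProd Y c n) := by
  induction n with
  | zero => exact @measurable_const _ _ _ (_) _
  | succ n ih =>
    have hmono : sigmaBefore Y n ≤ sigmaBefore Y (n + 1) :=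
      biSup_mono fun i hi => lt_trans hi (Nat.lt_succ_self n)
    have h1 := ih.mono hmono le_rfl
    have h2 : Measurable[sigmaBefore Y (n + 1)] (Y n) := by
      refine (comap_measurable (Y n)).mono ?_ le_rfl
      exact le_biSup (fun i => MeasurableSpace.comap (Y i) inferInstance)
        (Set.mem_Iio.2 (Nat.lt_succ_self n))
    exact Measurable.ite (measurableSet_le measurable_const h1) h1 (h1.mul h2)

variable [mΩ : MeasurableSpace Ω] {P : Measure Ω}

lemma sigmaBefore_le {Y : ℕ → Ω → ℝ≥0∞} (hY : ∀ i, Measurable (Y i)) (n : ℕ) :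
    sigmaBefore Y n ≤ mΩ :=
  iSup₂_le fun i _ => (hY i).comap_le

lemma indep_sigmaBefore {Y : ℕ → Ω → ℝ≥0∞} (hY : ∀ i, Measurable (Y i)) (hind : iIndepFun Y P)
    (n : ℕ) : Indep (sigmaBefore Y n) (MeasurableSpace.comap (Y n) inferInstance) P := by
  have := indep_iSup_of_disjoint (fun i => (hY i).comap_le) hind
    (S := Set.Iio n) (T := {n}) (by simp)
  rw [iSup_singleton] at this
  exact this

lemma measurable_stoppedProd {Y : ℕ → Ω → ℝ≥0∞} (hY : ∀ i, Measurable (Y i)) (c : ℝ≥0∞) (n : ℕ) :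
    Measurable (stoppedProd Y c n) :=
  (measurable_stoppedProd_sigmaBefore Y c n).mono (sigmaBefore_le hY n) le_rfl

/-- The frozen product is a supermartingale: both the freezing event and the current value depend on
the first `n` variables only, so the next factor is independent of them and has mean at most one. -/
lemma lintegral_stoppedProd_le [IsProbabilityMeasure P] {Y : ℕ → Ω → ℝ≥0∞}
    (hY : ∀ i, Measurable (Y i)) (hind : iIndepFun Y P) (hYle : ∀ i, ∫⁻ ω, Y i ω ∂P ≤ 1)
    (c : ℝ≥0∞) (n : ℕ) : ∫⁻ ω, stoppedProd Y c n ω ∂P ≤ 1 := by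
  induction n with
  | zero => simp [stoppedProd]
  | succ n ih =>
    have hZm := measurable_stoppedProd_sigmaBefore Y c n
    have hZ := measurable_stoppedProd hY c n
    set S := {ω | c ≤ stoppedProd Y c n ω} with hS
    have hSm : MeasurableSet[sigmaBefore Y n] S := measurableSet_le measurable_const hZm
    have hS' : MeasurableSet S := measurableSet_le measurable_const hZ
    have hmul : ∫⁻ ω, Sᶜ.indicator (stoppedProd Y c n) ω * Y n ω ∂P
        = (∫⁻ ω, Sᶜ.indicator (stoppedProd Y c n) ω ∂P) * ∫⁻ ω, Y n ω ∂P :=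
      lintegral_mul_eq_lintegral_mul_lintegral_of_independent_measurableSpace
        (sigmaBefore_le hY n) (hY n).comap_le (indep_sigmaBefore hY hind n)
        (hZm.indicator hSm.compl) (comap_measurable _)
    calc ∫⁻ ω, stoppedProd Y c (n + 1) ω ∂P
        = ∫⁻ ω, (S.indicator (stoppedProd Y c n) ω
            + Sᶜ.indicator (stoppedProd Y c n) ω * Y n ω) ∂P := by
          refine lintegral_congr fun ω => ?_
          by_cases h : c ≤ stoppedProd Y c n ω <;>
            simp [stoppedProd, Set.indicator, S, h]
      _ = ∫⁻ ω, S.indicator (stoppedProd Y c n) ω ∂P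
            + (∫⁻ ω, Sᶜ.indicator (stoppedProd Y c n) ω ∂P) * ∫⁻ ω, Y n ω ∂P := by
          rw [lintegral_add_left (hZ.indicator hS'), hmul]
      _ ≤ ∫⁻ ω, S.indicator (stoppedProd Y c n) ω ∂P
            + (∫⁻ ω, Sᶜ.indicator (stoppedProd Y c n) ω ∂P) * 1 := by
          gcongr; exact hYle n
      _ = ∫⁻ ω, stoppedProd Y c n ω ∂P := by
          rw [mul_one, lintegral_indicator hS', lintegral_indicator hS'.compl,
            lintegral_add_compl _ hS']
      _ ≤ 1 := ih

/-- **Ville's inequality** for products of independent nonnegative variables of mean at most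
one. -/
theorem measure_exists_le_prod_le [IsProbabilityMeasure P] {Y : ℕ → Ω → ℝ≥0∞}
    (hY : ∀ i, Measurable (Y i)) (hind : iIndepFun Y P) (hYle : ∀ i, ∫⁻ ω, Y i ω ∂P ≤ 1)
    {c : ℝ≥0∞} (hc : c ≠ 0) (hc' : c ≠ ⊤) :
    P {ω | ∃ n, c ≤ ∏ i ∈ Finset.range n, Y i ω} ≤ c⁻¹ := by
  -- Thanks to freezing the crossing events increase with `n`, so Markov's inequality at each fixed
  -- `n` passes to the union without loss.
  have hmono : Monotone fun n => {ω | c ≤ stoppedProd Y c n ω} := by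
    refine monotone_nat_of_le_succ fun n ω hω => ?_
    have h : c ≤ stoppedProd Y c n ω := hω
    simp [stoppedProd, h]
  have hsub : {ω | ∃ n, c ≤ ∏ i ∈ Finset.range n, Y i ω}
      ⊆ ⋃ n, {ω | c ≤ stoppedProd Y c n ω} := by
    rintro ω ⟨n, hn⟩
    refine Set.mem_iUnion.2 ⟨n, ?_⟩
    rcases stoppedProd_eq_prod_or_le Y c n ω with h | h
    · exact hn.trans h.ge
    · exact h
  refine (measure_mono hsub).trans ?_
  rw [hmono.measure_iUnion]
  refine iSup_le fun n => ?_
  refine (meas_ge_le_lintegral_div (measurable_stoppedProd hY c n).aemeasurable hc hc').trans ?_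
  rw [← one_div]
  gcongr
  exact lintegral_stoppedProd_le hY hind hYle c n

/-- The partial sums of independent centered sub-Gaussian variables stay below a line. -/
theorem measure_exists_line_le [IsProbabilityMeasure P] {Z : ℕ → Ω → ℝ}
    (hZ : ∀ i, Measurable (Z i)) (hind : iIndepFun Z P)
    (hsub : ∀ i, HasSubgaussianMGF (Z i) 1 P) (l a : ℝ) :
    P {ω | ∃ n : ℕ, a ≤ l * ∑ i ∈ Finset.range n, Z i ω - n * (l ^ 2 / 2)}
      ≤ ENNReal.ofReal (Real.exp (-a)) := by
  have hφ : Measurable fun z : ℝ => ENNReal.ofReal (Real.exp (l * z - l ^ 2 / 2)) := by fun_prop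
  have hle := measure_exists_le_prod_le (P := P)
    -- The sub-Gaussian bound on the moment generating function says exactly that these factors have
    -- mean at most one.
    (Y := fun i ω => ENNReal.ofReal (Real.exp (l * Z i ω - l ^ 2 / 2)))
    (fun i => hφ.comp (hZ i)) (hind.comp (fun _ => _) (fun _ => hφ))
    (fun i => by
      have hi : Integrable (fun ω => Real.exp (l * Z i ω - l ^ 2 / 2)) P := by
        simp_rw [Real.exp_sub]
        exact ((hsub i).integrable_exp_mul l).div_const _
      rw [← ofReal_integral_eq_lintegral_ofReal hi (ae_of_all _ fun _ => (Real.exp_pos _).le)]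
      rw [ENNReal.ofReal_le_one]
      simp_rw [Real.exp_sub]
      rw [integral_div, div_le_one (Real.exp_pos _)]
      simpa [mgf] using (hsub i).mgf_le l)
    (c := ENNReal.ofReal (Real.exp a)) (by simp [Real.exp_pos]) (by simp)
  rw [Real.exp_neg, ENNReal.ofReal_inv_of_pos (Real.exp_pos _)]
  refine (measure_mono ?_).trans hle
  rintro ω ⟨n, hn⟩
  refine ⟨n, ?_⟩
  rw [← ENNReal.ofReal_prod_of_nonneg (fun _ _ => (Real.exp_pos _).le), ← Real.exp_sum]
  refine ENNReal.ofReal_le_ofReal (Real.exp_le_exp.2 (hn.trans_eq ?_))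
  rw [Finset.sum_sub_distrib, ← Finset.mul_sum]
  simp

end Maximal

open scoped ENNReal

/-! ### A law-of-the-iterated-logarithm confidence bound -/

section Stitching

/-- The convex function `t ^ (-q)` lies above its tangent at `v`. This replaces the comparison of a
sum with an integral by telescoping. -/
lemma rpow_neg_sub_le {u v q : ℝ} (hu : 0 < u) (huv : u ≤ v) (hq : 0 < q) :
    q * (v - u) * v ^ (-(q + 1)) ≤ u ^ (-q) - v ^ (-q) := by
  have hv : 0 < v := hu.trans_le huv
  have h1 : 1 + q * (1 - u / v) ≤ (u / v) ^ (-q) := by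
    rw [Real.rpow_def_of_pos (div_pos hu hv)]
    have h2 := Real.add_one_le_exp (Real.log (u / v) * -q)
    have h3 := Real.log_le_sub_one_of_pos (div_pos hu hv)
    nlinarith
  rw [Real.div_rpow hu.le hv.le, le_div_iff₀ (Real.rpow_pos_of_pos hv _)] at h1
  have h4 : v ^ (-(q + 1)) = v ^ (-q) / v := by
    rw [neg_add, ← sub_eq_add_neg, Real.rpow_sub_one hv.ne']
  rw [h4]
  have h5 : (1 + q * (1 - u / v)) * v ^ (-q) = v ^ (-q) + q * (v - u) * (v ^ (-q) / v) := by
    field_simp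
  linarith

lemma sum_range_rpow_neg_le {s q : ℝ} (hs : 0 < s) (hq : 0 < q) (n : ℕ) :
    ∑ k ∈ Finset.range n, (1 + k * s) ^ (-(q + 1)) ≤ 1 + 1 / (s * q) := by
  have hsq : 0 < s * q := mul_pos hs hq
  -- The negative remainder is kept so that the induction telescopes; the term `k = 0` accounts for
  -- the leading 1.
  have key : ∀ n : ℕ, ∑ k ∈ Finset.range (n + 1), (1 + k * s) ^ (-(q + 1))
      ≤ 1 + (1 - (1 + n * s) ^ (-q)) / (s * q) := by
    intro n
    induction n with
    | zero => simp
    | succ n ih =>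
      rw [Finset.sum_range_succ]
      have hpos : 0 < 1 + (n : ℝ) * s := by positivity
      have h := rpow_neg_sub_le (u := 1 + n * s) (v := 1 + (n + 1 : ℕ) * s) hpos
        (by push_cast; nlinarith) hq
      have h' : (1 + ((n + 1 : ℕ) : ℝ) * s) ^ (-(q + 1))
          ≤ ((1 + n * s) ^ (-q) - (1 + ((n + 1 : ℕ) : ℝ) * s) ^ (-q)) / (s * q) := by
        rw [le_div_iff₀ hsq]
        refine le_trans (le_of_eq ?_) h
        push_cast; ring
      calc _ ≤ 1 + (1 - (1 + n * s) ^ (-q)) / (s * q)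
            + ((1 + n * s) ^ (-q) - (1 + ((n + 1 : ℕ) : ℝ) * s) ^ (-q)) / (s * q) :=
            add_le_add ih h'
        _ = _ := by ring
  have hn : ∑ k ∈ Finset.range n, (1 + (k : ℝ) * s) ^ (-(q + 1))
      ≤ ∑ k ∈ Finset.range (n + 1), (1 + (k : ℝ) * s) ^ (-(q + 1)) := by
    rw [Finset.sum_range_succ]
    have : (0 : ℝ) ≤ (1 + n * s) ^ (-(q + 1)) := by positivity
    linarith
  refine hn.trans ((key n).trans ?_)
  gcongr
  have : (0 : ℝ) ≤ (1 + n * s) ^ (-q) := by positivity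
  linarith

/-- Above, `exp` is bounded by its chord on `[0, 1/4]`, with `exp (1/4) ≤ 1.2841`; below, by its
tangent at 0. -/
lemma abs_one_sub_exp_le {s v : ℝ} (hs0 : 0 ≤ s) (hs : s ≤ 1) (hv : |v| ≤ s / 4) :
    |1 - Real.exp v| ≤ 0.2841 * s := by
  obtain ⟨h1, h2⟩ := abs_le.1 hv
  have hq : Real.exp (1 / 4) ≤ 1.2841 := by
    have h4 : Real.exp (1 / 4) ^ 4 = Real.exp 1 := by
      rw [← Real.exp_nat_mul]; norm_num
    have h5 : Real.exp (1 / 4) ^ 4 ≤ 1.2841 ^ 4 := by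
      rw [h4]; exact Real.exp_one_lt_d9.le.trans (by norm_num)
    exact le_of_pow_le_pow_left₀ (by norm_num) (by norm_num) h5
  have hconv := convexOn_exp.2 (Set.mem_univ (1 / 4 : ℝ)) (Set.mem_univ (0 : ℝ)) hs0
    (sub_nonneg.2 hs) (by ring)
  simp only [smul_eq_mul, mul_zero, add_zero, Real.exp_zero, mul_one] at hconv
  have hup : Real.exp v ≤ Real.exp (s * (1 / 4)) := Real.exp_le_exp.2 (by linarith)
  have hlow := Real.add_one_le_exp v
  rw [abs_le]
  constructor <;> nlinarith

/-- On a geometric slice of times, a curve `√(2 b T)` dominates a line. -/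
lemma line_le_of_sqrt_lt {b s S : ℝ} {T k : ℕ} (hb : 0 ≤ b) (hs0 : 0 ≤ s) (hs : s ≤ 1)
    (hT : 1 ≤ T) (hk : k * s ≤ Real.log T) (hk' : Real.log T ≤ (k + 1) * s)
    (hS : √(2 * b * T) ≤ S) :
    b * (1 - 0.0808 * s ^ 2) ≤ (√(2 * b) * Real.exp (-((k + 1 / 2) * s / 2))) * S
      - T * ((√(2 * b) * Real.exp (-((k + 1 / 2) * s / 2))) ^ 2 / 2) := by
  have hT0 : (0 : ℝ) < T := by exact_mod_cast hT
  -- The best slope at time `T` is `√(2b/T)`; here `T` is replaced by the geometric midpoint of the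
  -- slice, so `√T * e` is `exp v` with `|v| ≤ s/4`.
  set e := Real.exp (-((k + 1 / 2) * s / 2)) with he
  set v := Real.log T / 2 - (k + 1 / 2) * s / 2 with hv
  have hq : √(T : ℝ) * e = Real.exp v := by
    rw [he, hv, sub_eq_add_neg, Real.exp_add, ← Real.log_sqrt hT0.le,
      Real.exp_log (Real.sqrt_pos.2 hT0)]
  have hvabs : |v| ≤ s / 4 := by rw [abs_le]; constructor <;> simp only [hv] <;> linarith
  have h1 := abs_one_sub_exp_le hs0 hs hvabs
  rw [← hq] at h1
  have h2 : (1 - √(T : ℝ) * e) ^ 2 ≤ 0.0808 * s ^ 2 := by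
    rw [← sq_abs]
    have := pow_le_pow_left₀ (abs_nonneg _) h1 2
    nlinarith [sq_nonneg s]
  have hb2 : √(2 * b) ^ 2 = 2 * b := Real.sq_sqrt (by linarith)
  have hT2 : √(T : ℝ) ^ 2 = T := Real.sq_sqrt hT0.le
  rw [Real.sqrt_mul (by linarith : 0 ≤ 2 * b)] at hS
  have he0 : 0 ≤ √(2 * b) * e := by positivity
  have h3 := mul_le_mul_of_nonneg_left hS he0
  -- Completing the square: a wrong slope costs only the relative loss `(1 - √T * e)²`, and `0.2841²
  -- < 0.0808`.
  have h4 : √(2 * b) * e * (√(2 * b) * √(T : ℝ)) - T * ((√(2 * b) * e) ^ 2 / 2)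
      = b * (1 - (1 - √(T : ℝ) * e) ^ 2) := by
    linear_combination (√(T : ℝ) * e - T * e ^ 2 / 2) * hb2 + (b * e ^ 2) * hT2
  have h5 := mul_le_mul_of_nonneg_left h2 hb
  linarith

lemma exp_two_fifths_le : Real.exp (2 / 5) ≤ 1.5 := by
  have h4 : Real.exp (2 / 5) ^ 5 = Real.exp 1 ^ 2 := by
    rw [← Real.exp_nat_mul, ← Real.exp_nat_mul]; norm_num
  have h5 : Real.exp (2 / 5) ^ 5 ≤ 1.5 ^ 5 := by
    rw [h4]
    exact (pow_le_pow_left₀ (Real.exp_pos 1).le Real.exp_one_lt_d9.le 2).trans (by norm_num)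
  exact le_of_pow_le_pow_left₀ (by norm_num) (by norm_num) h5

lemma log_le_mul (L : ℝ) (hL : 0 < L) : Real.log L ≤ 0.37 * L := by
  have h := Real.log_le_sub_one_of_pos (div_pos hL (Real.exp_pos 1))
  rw [Real.log_div hL.ne' (Real.exp_pos 1).ne', Real.log_exp] at h
  have h2 : L / Real.exp 1 ≤ 0.37 * L := by
    rw [div_le_iff₀ (Real.exp_pos 1)]
    nlinarith [Real.exp_one_gt_d9]
  linarith

/-- Through this bound the cap `η ≤ 1/10` gives `log (1/η) ≥ 2.3`. -/
lemma log_ten_ge : 2.3 ≤ Real.log 10 := by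
  rw [Real.le_log_iff_exp_le (by norm_num)]
  have h4 : Real.exp 2.3 ^ 10 = Real.exp 1 ^ 23 := by
    rw [← Real.exp_nat_mul, ← Real.exp_nat_mul]; norm_num
  have h5 : Real.exp 2.3 ^ 10 ≤ 10 ^ 10 := by
    rw [h4]
    exact (pow_le_pow_left₀ (Real.exp_pos 1).le Real.exp_one_lt_d9.le 23).trans (by norm_num)
  exact le_of_pow_le_pow_left₀ (by norm_num) (by norm_num) h5

/-- The total mass of the stitched boundaries. -/
lemma sum_exp_neg_slice_le {L s : ℝ} (hL : 2.3 ≤ L) (hs0 : 0 < s) (hs2 : s ^ 2 * L = 2.3) (n : ℕ) :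
    ∑ k ∈ Finset.range n, Real.exp (-((L + 3 * Real.log L + 3 / 2 * Real.log (1 + k * s))
      * (1 - 0.0808 * s ^ 2))) ≤ Real.exp (-L) / 2 := by
  have hL0 : 0 < L := by linarith
  have hs1 : s ^ 2 ≤ 1 := by nlinarith
  have hs1' : s ≤ 1 := by nlinarith
  have hlog := log_le_mul L hL0
  have hlog0 : 0 ≤ Real.log L := Real.log_nonneg (by linarith)
  set E := Real.exp (-L) * L⁻¹ ^ 3 * 1.5 with hE
  have hterm : ∀ k : ℕ, Real.exp (-((L + 3 * Real.log L + 3 / 2 * Real.log (1 + k * s))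
      * (1 - 0.0808 * s ^ 2))) ≤ E * (1 + k * s) ^ (-((3 / 8 : ℝ) + 1)) := by
    intro k
    have hpos : 1 ≤ 1 + (k : ℝ) * s := by have : 0 ≤ (k : ℝ) * s := by positivity
                                          linarith
    have hlk : 0 ≤ Real.log (1 + k * s) := Real.log_nonneg hpos
    have h3 : L⁻¹ ^ 3 = Real.exp (-(3 * Real.log L)) := by
      rw [Real.exp_neg, mul_comm, Real.exp_mul, Real.exp_log hL0, inv_pow]; norm_cast
    calc _ ≤ Real.exp (-L + -(3 * Real.log L) + 2 / 5
            + Real.log (1 + k * s) * (-((3 / 8 : ℝ) + 1))) := by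
          apply Real.exp_le_exp.2
          -- Here `2.11 = 1 + 3 * 0.37`, and `s² L = 2.3` keeps the loss bounded whatever `L` is.
          have ha : (L + 3 * Real.log L) * (0.0808 * s ^ 2) ≤ 2 / 5 := by
            have : (L + 3 * Real.log L) * (0.0808 * s ^ 2) ≤ (2.11 * L) * (0.0808 * s ^ 2) := by
              gcongr; linarith
            nlinarith
          -- The loss leaves the exponent `3/2 * (1 - 0.0808) > 11/8`, so the series over slices
          -- still converges.
          have hb : Real.log (1 + k * s) * s ^ 2 ≤ Real.log (1 + k * s) := by nlinarith
          nlinarith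
      _ = Real.exp (-L) * L⁻¹ ^ 3 * Real.exp (2 / 5) * (1 + k * s) ^ (-((3 / 8 : ℝ) + 1)) := by
          rw [Real.exp_add, Real.exp_add, Real.exp_add, h3,
            Real.rpow_def_of_pos (by linarith : 0 < 1 + (k : ℝ) * s)]
      _ ≤ _ := by
          rw [hE]; gcongr; exact exp_two_fifths_le
  calc _ ≤ ∑ k ∈ Finset.range n, E * (1 + k * s) ^ (-((3 / 8 : ℝ) + 1)) :=
        Finset.sum_le_sum fun k _ => hterm k
    _ ≤ E * (1 + 1 / (s * (3 / 8))) := by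
        rw [← Finset.mul_sum]
        exact mul_le_mul_of_nonneg_left (sum_range_rpow_neg_le hs0 (by norm_num) n)
          (by positivity)
    _ ≤ _ := by
        -- The series contributes a factor of order `1/s`, which grows like `√L`; the term `3 log L`
        -- of the boundary gives `L⁻¹ ^ 3`, more than enough to pay for it.
        have hmain : 1.5 * (1 + 1 / (s * (3 / 8))) ≤ L ^ 3 / 2 := by
          have hLs : L = 2.3 / s ^ 2 := by field_simp; linarith
          rw [hLs]
          set y := 1 / s with hy
          have hy1 : 1 ≤ y := by rw [hy, le_div_iff₀ hs0]; linarith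
          have e1 : 1 / (s * (3 / 8)) = 8 / 3 * y := by rw [hy]; field_simp
          have e2 : (2.3 / s ^ 2) ^ 3 / 2 = 2.3 ^ 3 / 2 * y ^ 6 := by rw [hy]; field_simp
          rw [e1, e2]
          have : y ≤ y ^ 6 := le_self_pow₀ hy1 (by norm_num)
          nlinarith
        have hEe : E * (1 + 1 / (s * (3 / 8)))
            = Real.exp (-L) * L⁻¹ ^ 3 * (1.5 * (1 + 1 / (s * (3 / 8)))) := by rw [hE]; ring
        rw [hEe]
        calc _ ≤ Real.exp (-L) * L⁻¹ ^ 3 * (L ^ 3 / 2) := by gcongr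
          _ = _ := by field_simp

variable {Ω : Type*} [MeasurableSpace Ω] {P : Measure Ω}

/-- One-sided deviation bound, uniform over time, for sums of independent centered sub-Gaussian
variables. -/
theorem measure_exists_sqrt_lt_sum_le [IsProbabilityMeasure P] {Z : ℕ → Ω → ℝ}
    (hZ : ∀ i, Measurable (Z i)) (hind : iIndepFun Z P)
    (hsub : ∀ i, HasSubgaussianMGF (Z i) 1 P) {L : ℝ} (hL : 2.3 ≤ L) :
    P {ω | ∃ T : ℕ, 1 ≤ T ∧ √((2 * L + 6 * Real.log L + 3 * Real.log (1 + Real.log T)) * T)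
        < ∑ i ∈ Finset.range T, Z i ω} ≤ ENNReal.ofReal (Real.exp (-L) / 2) := by
  have hL0 : 0 < L := by linarith
  -- Slice `k` consists of the times with `k s ≤ log T ≤ (k + 1) s`; this choice of `s` makes the
  -- loss `s² L` constant.
  set s := √(2.3 / L) with hs
  have hs0 : 0 < s := Real.sqrt_pos.2 (by positivity)
  have hs2 : s ^ 2 * L = 2.3 := by
    rw [hs, Real.sq_sqrt (by positivity)]; field_simp
  have hs1 : s ≤ 1 := by
    rw [hs, Real.sqrt_le_one, div_le_one hL0]; exact hL
  have hlog0 : 0 ≤ Real.log L := Real.log_nonneg (by linarith)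
  set b : ℕ → ℝ := fun k => L + 3 * Real.log L + 3 / 2 * Real.log (1 + k * s) with hb
  have hb0 : ∀ k, 0 ≤ b k := fun k => by
    have : 0 ≤ Real.log (1 + k * s) := Real.log_nonneg (by
      have : 0 ≤ (k : ℝ) * s := by positivity
      linarith)
    simp only [hb]; linarith
  set l : ℕ → ℝ := fun k => √(2 * b k) * Real.exp (-((k + 1 / 2) * s / 2)) with hl
  have hcover : {ω | ∃ T : ℕ, 1 ≤ T ∧
        √((2 * L + 6 * Real.log L + 3 * Real.log (1 + Real.log T)) * T)
        < ∑ i ∈ Finset.range T, Z i ω}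
      ⊆ ⋃ k : ℕ, {ω | ∃ n : ℕ, b k * (1 - 0.0808 * s ^ 2)
          ≤ l k * ∑ i ∈ Finset.range n, Z i ω - n * (l k ^ 2 / 2)} := by
    rintro ω ⟨T, hT, hlt⟩
    have hT1 : (1 : ℝ) ≤ T := by exact_mod_cast hT
    have hlT : 0 ≤ Real.log T := Real.log_nonneg hT1
    set k := ⌊Real.log T / s⌋₊ with hk
    have hk1 : k * s ≤ Real.log T := by
      rw [← le_div_iff₀ hs0]; exact Nat.floor_le (by positivity)
    have hk2 : Real.log T ≤ (k + 1) * s := by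
      rw [← div_le_iff₀ hs0]; exact (Nat.lt_floor_add_one _).le
    refine Set.mem_iUnion.2 ⟨k, T, ?_⟩
    refine line_le_of_sqrt_lt (hb0 k) hs0.le hs1 hT hk1 hk2 (le_trans ?_ hlt.le)
    refine Real.sqrt_le_sqrt (mul_le_mul_of_nonneg_right ?_ (by positivity))
    have hks : 0 ≤ (k : ℝ) * s := by positivity
    have := Real.log_le_log (by linarith : 0 < 1 + (k : ℝ) * s)
      (by linarith : 1 + (k : ℝ) * s ≤ 1 + Real.log T)
    simp only [hb]; linarith
  refine (measure_mono hcover).trans ((measure_iUnion_le _).trans ?_)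
  refine ENNReal.tsum_le_of_sum_range_le fun n => ?_
  refine (Finset.sum_le_sum fun k _ => measure_exists_line_le hZ hind hsub (l k) _).trans ?_
  rw [← ENNReal.ofReal_sum_of_nonneg fun _ _ => (Real.exp_pos _).le]
  exact ENNReal.ofReal_le_ofReal (sum_exp_neg_slice_le hL hs0 hs2 n)

/-- All empirical means of the reward sequence `y` are within the confidence width of `m`. -/
def Concentrates (η m : ℝ) (y : ℕ → ℝ) : Prop :=
  ∀ T : ℕ, 1 ≤ T → |(∑ i ∈ Finset.range T, y i) / T - m| ≤ confWidth T η

lemma measurableSet_concentrates (η : ℝ) :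
    MeasurableSet {p : ℝ × (ℕ → ℝ) | Concentrates η p.1 p.2} := by
  have : {p : ℝ × (ℕ → ℝ) | Concentrates η p.1 p.2} = ⋂ T : ℕ, ⋂ _ : 1 ≤ T,
      {p : ℝ × (ℕ → ℝ) | |(∑ i ∈ Finset.range T, p.2 i) / (T : ℝ) - p.1| ≤ confWidth T η} := by
    ext p; simp [Concentrates]
  rw [this]
  refine MeasurableSet.iInter fun T => MeasurableSet.iInter fun _ => ?_
  exact measurableSet_le (by fun_prop) measurable_const

/-- With `L = log (1/η)`, each of the two tails costs `η/2`; `T * confWidth T η` is exactly the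
boundary for the sums. -/
lemma measure_not_concentrates_le_of_measurable [IsProbabilityMeasure P] {X : ℕ → Ω → ℝ} {m : ℝ}
    (hX : ∀ i, Measurable (X i)) (hind : iIndepFun X P)
    (hsub : ∀ i, HasSubgaussianMGF (fun ω => X i ω - m) 1 P) {η : ℝ} (hη : 0 < η)
    (hη' : η ≤ 1 / 10) :
    P {ω | ¬ Concentrates η m (fun t => X t ω)} ≤ ENNReal.ofReal η := by
  set L := Real.log (1 / η) with hL
  have hL' : 2.3 ≤ L := log_ten_ge.trans (Real.log_le_log (by norm_num) (by
    rw [le_div_iff₀ hη]; linarith))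
  have hexp : Real.exp (-L) = η := by
    rw [hL, Real.log_div one_ne_zero hη.ne', Real.log_one, zero_sub, neg_neg, Real.exp_log hη]
  have h1 := measure_exists_sqrt_lt_sum_le (P := P) (Z := fun i ω => X i ω - m)
    (fun i => (hX i).sub_const m)
    (hind.comp (fun _ x => x - m) (fun _ => measurable_id.sub_const m)) hsub hL'
  have h2 := measure_exists_sqrt_lt_sum_le (P := P) (Z := fun i ω => -(X i ω - m))
    (fun i => ((hX i).sub_const m).neg)
    (hind.comp (fun _ x => -(x - m)) (fun _ => (measurable_id.sub_const m).neg))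
    (fun i => (hsub i).neg) hL'
  rw [hexp] at h1 h2
  have hsum : ENNReal.ofReal (η / 2) + ENNReal.ofReal (η / 2) = ENNReal.ofReal η := by
    rw [← ENNReal.ofReal_add (by positivity) (by positivity), add_halves]
  rw [← hsum]
  refine (measure_mono ?_).trans ((measure_union_le _ _).trans (add_le_add h1 h2))
  intro ω hω
  simp only [Set.mem_ofPred_eq, Concentrates, not_forall, not_le] at hω
  obtain ⟨T, hT, hlt⟩ := hω
  have hT0 : (0 : ℝ) < T := by exact_mod_cast hT
  set W := 2 * L + 6 * Real.log L + 3 * Real.log (1 + Real.log T) with hW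
  have hc : confWidth T η = √(W * T) / T := by
    have hlT : Real.log (Real.exp 1 * T) = 1 + Real.log T := by
      rw [Real.log_mul (Real.exp_pos 1).ne' hT0.ne', Real.log_exp]
    rw [confWidth, hlT, ← hL, ← hW]
    have : W / T = (W * T) / (T : ℝ) ^ 2 := by field_simp
    rw [this, Real.sqrt_div' _ (by positivity), Real.sqrt_sq hT0.le]
  have hs : ∑ i ∈ Finset.range T, (X i ω - m) = ∑ i ∈ Finset.range T, X i ω - T * m := by
    simp [Finset.sum_sub_distrib]
  have hdiv : (∑ i ∈ Finset.range T, X i ω) / T - m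
      = (∑ i ∈ Finset.range T, (X i ω - m)) / T := by
    rw [hs]; field_simp
  rw [hdiv, hc, abs_div, abs_of_pos hT0, div_lt_div_iff_of_pos_right hT0, lt_abs] at hlt
  rcases hlt with h | h
  · exact Or.inl ⟨T, hT, h⟩
  · exact Or.inr ⟨T, hT, by rw [Finset.sum_neg_distrib]; exact h⟩

/-- Uniform-in-time confidence bound for the empirical means of i.i.d. rewards. -/
theorem measure_not_concentrates_le [IsProbabilityMeasure P] {X : ℕ → Ω → ℝ} {ν : Measure ℝ}
    {m : ℝ} (hν : IsRewardLaw ν m) (hX : ∀ t, HasLaw (X t) ν P) (hind : iIndepFun X P) {η : ℝ}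
    (hη : 0 < η) (hη' : η ≤ 1 / 10) :
    P {ω | ¬ Concentrates η m (fun t => X t ω)} ≤ ENNReal.ofReal η := by
  have hprob : IsProbabilityMeasure ν := (hX 0).isProbabilityMeasure_iff.1 inferInstance
  have hmeas : AEMeasurable (fun ω i => X i ω) P :=
    aemeasurable_pi_lambda _ fun i => (hX i).aemeasurable
  have hlaw := hind.hasLaw_infinitePi hX hmeas
  -- The rewards are only a.e. measurable, so the estimate is carried out for the coordinates of the
  -- product space.
  refine (Measure.le_map_apply hmeas {y | ¬ Concentrates η m y}).trans ?_
  rw [hlaw.map_eq]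
  have hsub : ∀ i : ℕ, HasSubgaussianMGF (fun y : ℕ → ℝ => y i - m) 1
      (Measure.infinitePi fun _ : ℕ => ν) := fun i => by
    have hev : HasLaw (fun y : ℕ → ℝ => y i) ν (Measure.infinitePi fun _ : ℕ => ν) :=
      (measurePreserving_eval_infinitePi (fun _ : ℕ => ν) i).hasLaw
    have := hν.subgaussian
    rw [← hev.map_eq] at this
    exact this.of_map hev.aemeasurable
  have hind' : iIndepFun (fun (i : ℕ) (y : ℕ → ℝ) => y i) (Measure.infinitePi fun _ : ℕ => ν) :=
    iIndepFun_infinitePi (P := fun _ : ℕ => ν) (X := fun _ x => x) fun _ => measurable_id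
  exact measure_not_concentrates_le_of_measurable (fun i => measurable_pi_apply i) hind' hsub hη hη'

end Stitching

/-! ### Quantiles of finite multisets -/

section Quantile

variable {A : Type*} {S : Finset A} {p : ℝ}

lemma empCDF_mono_of_imp {v w : A → ℝ} {x y : ℝ} (h : ∀ j ∈ S, v j ≤ x → w j ≤ y) :
    empCDF S v x ≤ empCDF S w y := by
  classical
  unfold empCDF
  refine div_le_div_of_nonneg_right (Nat.cast_le.2 (Finset.card_le_card fun j hj => ?_))
    (Nat.cast_nonneg _)
  rw [Finset.mem_filter] at hj ⊢
  exact ⟨hj.1, h j hj.1 hj.2⟩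

lemma exists_le_of_le_empCDF (hp : 0 < p) {v : A → ℝ} {x : ℝ} (h : p ≤ empCDF S v x) :
    ∃ j ∈ S, v j ≤ x := by
  classical
  by_contra! hcon
  have : S.filter (fun j => v j ≤ x) = ∅ :=
    Finset.filter_eq_empty_iff.2 fun j hj => not_le.2 (hcon j hj)
  unfold empCDF at h
  have h2 : ((S.filter (fun j => v j ≤ x)).card : ℝ) / S.card = 0 := by rw [this]; simp
  have h3 : p ≤ 0 := by
    refine h.trans (le_of_eq ?_)
    convert h2
  linarith

/-- The empirical CDF jumps only at values of `v`: any level reaching `p > 0` can be lowered to the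
largest value below it. Hence the infimum is attained, at one of the arms. -/
lemma exists_isLeast_empCDF (hS : S.Nonempty) (hp : 0 < p) (hp1 : p ≤ 1) (v : A → ℝ) :
    ∃ j ∈ S, IsLeast {x : ℝ | p ≤ empCDF S v x} (v j) := by
  classical
  have hdown : ∀ x, p ≤ empCDF S v x → ∃ j ∈ S, v j ≤ x ∧ p ≤ empCDF S v (v j) := by
    intro x hx
    obtain ⟨j₀, hj₀, hle₀⟩ := exists_le_of_le_empCDF hp hx
    obtain ⟨j, hj, hmax⟩ := Finset.exists_max_image (S.filter (fun j => v j ≤ x)) v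
      ⟨j₀, Finset.mem_filter.2 ⟨hj₀, hle₀⟩⟩
    rw [Finset.mem_filter] at hj
    exact ⟨j, hj.1, hj.2, hx.trans (empCDF_mono_of_imp fun i hi hix =>
      hmax i (Finset.mem_filter.2 ⟨hi, hix⟩))⟩
  obtain ⟨j₁, hj₁, hmax₁⟩ := Finset.exists_max_image S v hS
  have htop : p ≤ empCDF S v (v j₁) := by
    have h1 : S.filter (fun j => v j ≤ v j₁) = S := Finset.filter_true_of_mem hmax₁
    have h2 : ((S.filter (fun j => v j ≤ v j₁)).card : ℝ) / S.card = 1 := by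
      rw [h1, div_self]
      exact_mod_cast hS.card_pos.ne'
    refine hp1.trans (le_of_eq ?_)
    unfold empCDF
    rw [← h2]
  obtain ⟨j, hj, hmin⟩ := Finset.exists_min_image (S.filter fun j => p ≤ empCDF S v (v j)) v
    ⟨j₁, Finset.mem_filter.2 ⟨hj₁, htop⟩⟩
  rw [Finset.mem_filter] at hj
  refine ⟨j, hj.1, hj.2, fun x hx => ?_⟩
  obtain ⟨i, hi, hix, hip⟩ := hdown x hx
  exact (hmin i (Finset.mem_filter.2 ⟨hi, hip⟩)).trans hix

lemma exists_quantile_eq (hS : S.Nonempty) (hp : 0 < p) (hp1 : p ≤ 1) (v : A → ℝ) :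
    ∃ j ∈ S, quantile p S v = v j := by
  obtain ⟨j, hj, h⟩ := exists_isLeast_empCDF hS hp hp1 v
  exact ⟨j, hj, h.csInf_eq⟩

lemma isLeast_quantile (hS : S.Nonempty) (hp : 0 < p) (hp1 : p ≤ 1) (v : A → ℝ) :
    IsLeast {x : ℝ | p ≤ empCDF S v x} (quantile p S v) := by
  obtain ⟨j, _, h⟩ := exists_isLeast_empCDF hS hp hp1 v
  rw [quantile, h.csInf_eq]
  exact h

/-- The arms below the quantile of `v` already make up a fraction `p`, so only they need to be
controlled. The arms above it may have arbitrary `w`, which is what allows stale confidence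
intervals. -/
lemma quantile_le_of_imp (hS : S.Nonempty) (hp : 0 < p) (hp1 : p ≤ 1) {v w : A → ℝ} {u : ℝ}
    (h : ∀ j ∈ S, v j ≤ quantile p S v → w j ≤ u) : quantile p S w ≤ u :=
  (isLeast_quantile hS hp hp1 w).2
    ((isLeast_quantile hS hp hp1 v).1.trans (empCDF_mono_of_imp h))

/-- If the quantile of `w` were below `l`, a fraction `p` of the arms would have `v` strictly below
its own quantile; the largest such `v` gives the contradiction. -/
lemma le_quantile_of_imp (hS : S.Nonempty) (hp : 0 < p) (hp1 : p ≤ 1) {v w : A → ℝ} {l : ℝ}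
    (h : ∀ j ∈ S, w j < l → v j < quantile p S v) : l ≤ quantile p S w := by
  classical
  by_contra! hlt
  obtain ⟨j₀, hj₀, hle₀⟩ := exists_le_of_le_empCDF hp (isLeast_quantile hS hp hp1 w).1
  obtain ⟨j, hj, hmax⟩ := Finset.exists_max_image (S.filter (fun j => w j ≤ quantile p S w)) v
    ⟨j₀, Finset.mem_filter.2 ⟨hj₀, hle₀⟩⟩
  rw [Finset.mem_filter] at hj
  have h1 : quantile p S v ≤ v j := quantile_le_of_imp hS hp hp1 (v := w) fun i hi hiw =>
    hmax i (Finset.mem_filter.2 ⟨hi, hiw⟩)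
  exact absurd h1 (not_le.2 (h j hj.1 (hj.2.trans_lt hlt)))

lemma quantile_mono (hS : S.Nonempty) (hp : 0 < p) (hp1 : p ≤ 1) {v w : A → ℝ}
    (h : ∀ j ∈ S, v j ≤ w j) : quantile p S v ≤ quantile p S w :=
  quantile_le_of_imp hS hp hp1 fun j hj hle => (h j hj).trans hle

end Quantile

/-! ### Gaps of groups and arms -/

section Gaps

variable {A H : Type*} [Fintype A] {grp : A → H} {α : ℝ}

lemma mem_arms {h : H} {j : A} : j ∈ arms grp h ↔ grp j = h := by
  simp [arms]

lemma arms_nonempty (hgrp : Function.Surjective grp) (h : H) : (arms grp h).Nonempty := by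
  obtain ⟨j, hj⟩ := hgrp h
  exact ⟨j, mem_arms.2 hj⟩

lemma groupQuantile_mem_Icc (hgrp : Function.Surjective grp) (hα : α ∈ Set.Ioo (0 : ℝ) 1)
    {μ : A → ℝ} (hμ : ∀ j, μ j ∈ Set.Icc (0 : ℝ) 1) (h : H) :
    groupQuantile grp α μ h ∈ Set.Icc (0 : ℝ) 1 := by
  obtain ⟨j, _, hj⟩ := exists_quantile_eq (arms_nonempty hgrp h) (p := 1 - α)
    (by linarith [hα.2]) (by linarith [hα.1]) μ
  rw [groupQuantile, hj]
  exact hμ j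

lemma le_armGap (α Δ : ℝ) (μ : A → ℝ) (hs : H) (j : A) : Δ ≤ armGap grp α Δ μ hs j :=
  (le_max_left _ _).trans (le_max_left _ _)

variable [Fintype H]

lemma bestGap_le_groupGap (α : ℝ) (μ : A → ℝ) {hs h : H} (hne : h ≠ hs) :
    bestGap grp α μ hs ≤ groupGap grp α μ hs h :=
  ciInf_le (Set.finite_range fun h : {h : H // h ≠ hs} => groupGap grp α μ hs h).bddBelow ⟨h, hne⟩

lemma bestGap_le_one (hgrp : Function.Surjective grp) (hα : α ∈ Set.Ioo (0 : ℝ) 1)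
    {μ : A → ℝ} (hμ : ∀ j, μ j ∈ Set.Icc (0 : ℝ) 1) (hs : H) : bestGap grp α μ hs ≤ 1 := by
  by_cases hex : ∃ h, h ≠ hs
  · obtain ⟨h, hne⟩ := hex
    refine (bestGap_le_groupGap α μ hne).trans ?_
    have h1 := groupQuantile_mem_Icc hgrp hα hμ hs
    have h2 := groupQuantile_mem_Icc hgrp hα hμ h
    unfold groupGap
    linarith [h1.2, h2.1]
  · have : IsEmpty {h : H // h ≠ hs} := ⟨fun h => hex ⟨h.1, h.2⟩⟩
    -- With a single group the real infimum over an empty type is 0, which matches the convention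
    -- for `Δ₀`.
    rw [bestGap, Real.iInf_of_isEmpty]
    exact zero_le_one

/-- Gaps at most one keep `log (e / Δ_j²) ≥ 1`, so the iterated logarithms in the bound are
nonnegative. -/
lemma armGap_le_one (hgrp : Function.Surjective grp) (hα : α ∈ Set.Ioo (0 : ℝ) 1) {Δ : ℝ}
    (hΔ : Δ ≤ 1) {μ : A → ℝ} (hμ : ∀ j, μ j ∈ Set.Icc (0 : ℝ) 1) (hs : H) (j : A) :
    armGap grp α Δ μ hs j ≤ 1 := by
  have h1 := groupQuantile_mem_Icc hgrp hα hμ hs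
  have h2 := groupQuantile_mem_Icc hgrp hα hμ (grp j)
  have h3 := hμ j
  refine max_le (max_le hΔ ?_) (max_le (bestGap_le_one hgrp hα hμ hs) ?_)
  · unfold groupGap; linarith [h1.2, h2.1]
  · rw [abs_le]; constructor <;> linarith [h3.1, h3.2, h2.1, h2.2]

end Gaps

/-! ### The run of the algorithm on concentrated rewards -/

section Run

variable {A H : Type*} [Fintype A] [Fintype H] {grp : A → H} {α δ : ℝ} {x : A → ℕ → ℝ}

lemma seRun_cand_succ (k : ℕ) (h : H) :
    h ∈ (seRun grp α δ x (k + 1)).cand ↔ h ∈ (seRun grp α δ x k).cand ∧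
      ∀ h' ∈ (seRun grp α δ x k).cand,
        groupQuantile grp α ((seRun grp α δ x (k + 1)).lcb δ) h'
          ≤ groupQuantile grp α ((seRun grp α δ x (k + 1)).ucb δ) h := by
  classical
  exact Finset.mem_filter

lemma seRun_pot_succ (k : ℕ) (h : H) (j : A) :
    j ∈ (seRun grp α δ x (k + 1)).pot h ↔ j ∈ (seRun grp α δ x k).pot h ∧
      (seRun grp α δ x (k + 1)).lcb δ j
        ≤ groupQuantile grp α ((seRun grp α δ x (k + 1)).ucb δ) h ∧
      groupQuantile grp α ((seRun grp α δ x (k + 1)).lcb δ) h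
        ≤ (seRun grp α δ x (k + 1)).ucb δ j := by
  classical
  exact Finset.mem_filter

lemma seRun_gap_succ (k : ℕ) :
    (seRun grp α δ x (k + 1)).gap
      = ((seRun grp α δ x (k + 1)).spread grp α δ (seRun grp α δ x (k + 1)).cand : ℝ) := rfl

lemma seRun_count_succ_of_active {k : ℕ} {j : A} (h : (seRun grp α δ x k).IsActive j) :
    (seRun grp α δ x (k + 1)).count j = (seRun grp α δ x k).count j + 1 := if_pos h

lemma seRun_count_succ_of_not_active {k : ℕ} {j : A} (h : ¬ (seRun grp α δ x k).IsActive j) :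
    (seRun grp α δ x (k + 1)).count j = (seRun grp α δ x k).count j := if_neg h

lemma seRun_total_succ_of_active {k : ℕ} {j : A} (h : (seRun grp α δ x k).IsActive j) :
    (seRun grp α δ x (k + 1)).total j = (seRun grp α δ x k).total j + x j k := if_pos h

lemma seRun_total_succ_of_not_active {k : ℕ} {j : A} (h : ¬ (seRun grp α δ x k).IsActive j) :
    (seRun grp α δ x (k + 1)).total j = (seRun grp α δ x k).total j := if_neg h

lemma seRun_pot_subset_arms (k : ℕ) (h : H) : (seRun grp α δ x k).pot h ⊆ arms grp h := by
  induction k with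
  | zero => exact subset_rfl
  | succ k ih => exact fun j hj => ih ((seRun_pot_succ k h j).1 hj).1

lemma seRun_isActive_iff (k : ℕ) (j : A) : (seRun grp α δ x k).IsActive j ↔
    grp j ∈ (seRun grp α δ x k).cand ∧ j ∈ (seRun grp α δ x k).pot (grp j) := by
  constructor
  · rintro ⟨h, hc, hp⟩
    obtain rfl := mem_arms.1 (seRun_pot_subset_arms k h hp)
    exact ⟨hc, hp⟩
  · rintro ⟨hc, hp⟩
    exact ⟨_, hc, hp⟩

lemma seRun_isActive_of_succ {k : ℕ} {j : A} (h : (seRun grp α δ x (k + 1)).IsActive j) :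
    (seRun grp α δ x k).IsActive j := by
  obtain ⟨g, hc, hp⟩ := h
  exact ⟨g, ((seRun_cand_succ k g).1 hc).1, ((seRun_pot_succ k g j).1 hp).1⟩

lemma seRun_isActive_zero (j : A) : (seRun grp α δ x 0).IsActive j :=
  ⟨grp j, Finset.mem_univ _, mem_arms.2 rfl⟩

/-- Activity is never regained, so an arm that is still active was pulled in every previous round.
-/
lemma seRun_count_of_active {k : ℕ} {j : A} (h : (seRun grp α δ x k).IsActive j) :
    (seRun grp α δ x k).count j = k := by
  induction k with
  | zero => rfl
  | succ k ih =>
    have h' := seRun_isActive_of_succ h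
    rw [seRun_count_succ_of_active h', ih h']

/-- The rounds in which an arm is pulled form an initial segment, so its data are a prefix of its
reward sequence; this is where `Concentrates` becomes applicable. -/
lemma seRun_total (k : ℕ) (j : A) : (seRun grp α δ x k).total j
    = ∑ i ∈ Finset.range ((seRun grp α δ x k).count j), x j i := by
  induction k with
  | zero => rfl
  | succ k ih =>
    by_cases h : (seRun grp α δ x k).IsActive j
    · rw [seRun_total_succ_of_active h, seRun_count_succ_of_active h, Finset.sum_range_succ, ih,
        seRun_count_of_active h]
    · rw [seRun_total_succ_of_not_active h, seRun_count_succ_of_not_active h, ih]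

lemma seRun_count_pos (k : ℕ) (j : A) : 1 ≤ (seRun grp α δ x (k + 1)).count j := by
  induction k with
  | zero => exact (seRun_count_succ_of_active (seRun_isActive_zero j)).ge
  | succ k ih =>
    by_cases h : (seRun grp α δ x (k + 1)).IsActive j
    · rw [seRun_count_succ_of_active h]; omega
    · rw [seRun_count_succ_of_not_active h]; exact ih

/-- The last pull of an arm is made in a round at whose beginning the arm is active. -/
lemma seRun_count_eq_zero_or_active (k : ℕ) (j : A) : (seRun grp α δ x k).count j = 0 ∨
    ∃ t < k, (seRun grp α δ x k).count j = t + 1 ∧ (seRun grp α δ x t).IsActive j := by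
  induction k with
  | zero => exact Or.inl rfl
  | succ k ih =>
    by_cases h : (seRun grp α δ x k).IsActive j
    · refine Or.inr ⟨k, Nat.lt_succ_self k, ?_, h⟩
      rw [seRun_count_succ_of_active h, seRun_count_of_active h]
    · rw [seRun_count_succ_of_not_active h]
      rcases ih with ih | ⟨t, ht, ih⟩
      · exact Or.inl ih
      · exact Or.inr ⟨t, ht.trans (Nat.lt_succ_self k), ih⟩

lemma seRun_lcb_succ_of_not_active {k : ℕ} {j : A} (h : ¬ (seRun grp α δ x k).IsActive j) :
    (seRun grp α δ x (k + 1)).lcb δ j = (seRun grp α δ x k).lcb δ j := by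
  simp only [SEState.lcb, SEState.mean, SEState.width, seRun_count_succ_of_not_active h,
    seRun_total_succ_of_not_active h]

lemma seRun_ucb_succ_of_not_active {k : ℕ} {j : A} (h : ¬ (seRun grp α δ x k).IsActive j) :
    (seRun grp α δ x (k + 1)).ucb δ j = (seRun grp α δ x k).ucb δ j := by
  simp only [SEState.ucb, SEState.mean, SEState.width, seRun_count_succ_of_not_active h,
    seRun_total_succ_of_not_active h]

/-- The rewards of every arm concentrate around its mean, at the confidence level used by the
algorithm. -/
def AllConcentrate (δ : ℝ) (μ : A → ℝ) (x : A → ℕ → ℝ) : Prop :=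
  ∀ j, Concentrates (min (δ / Fintype.card A) (1 / 10)) (μ j) (x j)

variable {μ : A → ℝ}

/-- Every arm is pulled in the first round, so from then on its interval is valid, even when frozen.
At index 0 the empirical mean is `0 / 0`, hence the shift to `k + 1`. -/
lemma AllConcentrate.abs_mean_sub_le (hx : AllConcentrate δ μ x) (k : ℕ) (j : A) :
    |(seRun grp α δ x (k + 1)).mean j - μ j| ≤ (seRun grp α δ x (k + 1)).width δ j := by
  have := hx j _ (seRun_count_pos (grp := grp) (α := α) (δ := δ) (x := x) k j)
  rw [← seRun_total] at this
  exact this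

lemma AllConcentrate.lcb_le (hx : AllConcentrate δ μ x) (k : ℕ) (j : A) :
    (seRun grp α δ x (k + 1)).lcb δ j ≤ μ j := by
  have := abs_le.1 (hx.abs_mean_sub_le (grp := grp) (α := α) k j)
  unfold SEState.lcb; linarith [this.2]

lemma AllConcentrate.le_ucb (hx : AllConcentrate δ μ x) (k : ℕ) (j : A) :
    μ j ≤ (seRun grp α δ x (k + 1)).ucb δ j := by
  have := abs_le.1 (hx.abs_mean_sub_le (grp := grp) (α := α) k j)
  unfold SEState.ucb; linarith [this.1]

/-- The confidence width of an arm pulled in all of the first `T` rounds. -/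
noncomputable def roundWidth (A : Type*) [Fintype A] (δ : ℝ) (T : ℕ) : ℝ :=
  confWidth T (min (δ / Fintype.card A) (1 / 10))

lemma seRun_width_of_active {k : ℕ} {j : A} (h : (seRun grp α δ x k).IsActive j) :
    (seRun grp α δ x (k + 1)).width δ j = roundWidth A δ (k + 1) := by
  rw [SEState.width, seRun_count_succ_of_active h, seRun_count_of_active h, roundWidth]

lemma AllConcentrate.le_lcb_of_active (hx : AllConcentrate δ μ x) {k : ℕ} {j : A}
    (h : (seRun grp α δ x k).IsActive j) :
    μ j - 2 * roundWidth A δ (k + 1) ≤ (seRun grp α δ x (k + 1)).lcb δ j := by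
  have h1 := abs_le.1 (hx.abs_mean_sub_le (grp := grp) (α := α) k j)
  rw [seRun_width_of_active h] at h1
  rw [SEState.lcb, seRun_width_of_active h]; linarith [h1.1]

lemma AllConcentrate.ucb_le_of_active (hx : AllConcentrate δ μ x) {k : ℕ} {j : A}
    (h : (seRun grp α δ x k).IsActive j) :
    (seRun grp α δ x (k + 1)).ucb δ j ≤ μ j + 2 * roundWidth A δ (k + 1) := by
  have h1 := abs_le.1 (hx.abs_mean_sub_le (grp := grp) (α := α) k j)
  rw [seRun_width_of_active h] at h1
  rw [SEState.ucb, seRun_width_of_active h]; linarith [h1.2]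

lemma AllConcentrate.quantile_lcb_le (hgrp : Function.Surjective grp)
    (hα : α ∈ Set.Ioo (0 : ℝ) 1) (hx : AllConcentrate δ μ x) (k : ℕ) (h : H) :
    groupQuantile grp α ((seRun grp α δ x (k + 1)).lcb δ) h ≤ groupQuantile grp α μ h :=
  quantile_mono (arms_nonempty hgrp h) (by linarith [hα.2]) (by linarith [hα.1])
    fun j _ => hx.lcb_le k j

lemma AllConcentrate.le_quantile_ucb (hgrp : Function.Surjective grp)
    (hα : α ∈ Set.Ioo (0 : ℝ) 1) (hx : AllConcentrate δ μ x) (k : ℕ) (h : H) :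
    groupQuantile grp α μ h ≤ groupQuantile grp α ((seRun grp α δ x (k + 1)).ucb δ) h :=
  quantile_mono (arms_nonempty hgrp h) (by linarith [hα.2]) (by linarith [hα.1])
    fun j _ => hx.le_ucb k j

/-- The confidence interval of an eliminated arm does not contain the quantile of its group. -/
lemma AllConcentrate.eliminated (hgrp : Function.Surjective grp)
    (hα : α ∈ Set.Ioo (0 : ℝ) 1) (hx : AllConcentrate δ μ x) {k : ℕ} {j : A}
    (hj : j ∉ (seRun grp α δ x k).pot (grp j)) :
    groupQuantile grp α μ (grp j) < (seRun grp α δ x k).lcb δ j ∨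
      (seRun grp α δ x k).ucb δ j < groupQuantile grp α μ (grp j) := by
  induction k with
  | zero => exact absurd (mem_arms.2 rfl) hj
  | succ k ih =>
    by_cases hk : j ∈ (seRun grp α δ x k).pot (grp j)
    · rw [seRun_pot_succ] at hj
      have hL := hx.quantile_lcb_le hgrp hα k (grp j)
      have hR := hx.le_quantile_ucb hgrp hα k (grp j)
      by_contra! hcon
      exact hj ⟨hk, hcon.1.trans hR, hL.trans hcon.2⟩
    -- An arm dropped earlier is no longer pulled, so its interval is the one that already missed
    -- the quantile.
    · have hna : ¬ (seRun grp α δ x k).IsActive j :=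
        fun h => hk ((seRun_isActive_iff k j).1 h).2
      rw [seRun_lcb_succ_of_not_active hna, seRun_ucb_succ_of_not_active hna]
      exact ih hk

lemma AllConcentrate.eliminated_succ (hgrp : Function.Surjective grp)
    (hα : α ∈ Set.Ioo (0 : ℝ) 1) (hx : AllConcentrate δ μ x) {k : ℕ} {j : A}
    (hj : j ∉ (seRun grp α δ x k).pot (grp j)) :
    groupQuantile grp α μ (grp j) < (seRun grp α δ x (k + 1)).lcb δ j ∨
      (seRun grp α δ x (k + 1)).ucb δ j < groupQuantile grp α μ (grp j) :=
  hx.eliminated hgrp hα fun h => hj ((seRun_pot_succ k _ j).1 h).1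

/-- Only arms with mean at most the quantile matter. A potential one has UCB within `2U` of its
mean; an eliminated one has an interval containing its mean and missing the quantile, hence lying
entirely below it. -/
lemma AllConcentrate.quantile_ucb_le (hgrp : Function.Surjective grp)
    (hα : α ∈ Set.Ioo (0 : ℝ) 1) (hx : AllConcentrate δ μ x) {k : ℕ} {h : H}
    (hh : h ∈ (seRun grp α δ x k).cand) :
    groupQuantile grp α ((seRun grp α δ x (k + 1)).ucb δ) h
      ≤ groupQuantile grp α μ h + 2 * roundWidth A δ (k + 1) := by
  refine quantile_le_of_imp (arms_nonempty hgrp h) (by linarith [hα.2]) (by linarith [hα.1])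
    (v := μ) fun j hj hle => ?_
  change μ j ≤ groupQuantile grp α μ h at hle
  obtain rfl := mem_arms.1 hj
  have hw : 0 ≤ roundWidth A δ (k + 1) := Real.sqrt_nonneg _
  by_cases hp : j ∈ (seRun grp α δ x k).pot (grp j)
  · linarith [hx.ucb_le_of_active ⟨_, hh, hp⟩]
  · rcases hx.eliminated_succ hgrp hα hp with h1 | h1
    · linarith [hx.lcb_le (grp := grp) (α := α) k j]
    · linarith

lemma AllConcentrate.le_quantile_lcb (hgrp : Function.Surjective grp)
    (hα : α ∈ Set.Ioo (0 : ℝ) 1) (hx : AllConcentrate δ μ x) {k : ℕ} {h : H}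
    (hh : h ∈ (seRun grp α δ x k).cand) :
    groupQuantile grp α μ h - 2 * roundWidth A δ (k + 1)
      ≤ groupQuantile grp α ((seRun grp α δ x (k + 1)).lcb δ) h := by
  refine le_quantile_of_imp (arms_nonempty hgrp h) (by linarith [hα.2]) (by linarith [hα.1])
    (v := μ) fun j hj hlt => ?_
  change μ j < groupQuantile grp α μ h
  obtain rfl := mem_arms.1 hj
  have hw : 0 ≤ roundWidth A δ (k + 1) := Real.sqrt_nonneg _
  by_cases hp : j ∈ (seRun grp α δ x k).pot (grp j)
  · linarith [hx.le_lcb_of_active ⟨_, hh, hp⟩]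
  · rcases hx.eliminated_succ hgrp hα hp with h1 | h1
    · linarith
    · linarith [hx.le_ucb (grp := grp) (α := α) k j]

/-- A best group is never eliminated. -/
lemma AllConcentrate.best_mem_cand (hgrp : Function.Surjective grp)
    (hα : α ∈ Set.Ioo (0 : ℝ) 1) (hx : AllConcentrate δ μ x) {hs : H}
    (hbest : IsBest grp α μ hs) (k : ℕ) : hs ∈ (seRun grp α δ x k).cand := by
  induction k with
  | zero => exact Finset.mem_univ _
  | succ k ih =>
    refine (seRun_cand_succ k hs).2 ⟨ih, fun h' _ => ?_⟩
    exact (hx.quantile_lcb_le hgrp hα k h').trans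
      ((hbest h').trans (hx.le_quantile_ucb hgrp hα k hs))

/-- A surviving group has upper bound at least the lower bound of the best group; each bound is off
by at most `2U`. -/
lemma AllConcentrate.groupGap_le (hgrp : Function.Surjective grp)
    (hα : α ∈ Set.Ioo (0 : ℝ) 1) (hx : AllConcentrate δ μ x) {hs : H}
    (hbest : IsBest grp α μ hs) {k : ℕ} {h : H} (hh : h ∈ (seRun grp α δ x (k + 1)).cand) :
    groupGap grp α μ hs h ≤ 4 * roundWidth A δ (k + 1) := by
  obtain ⟨h1, h2⟩ := (seRun_cand_succ k h).1 hh
  have hb := hx.best_mem_cand hgrp hα hbest k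
  have h3 := h2 hs hb
  have h4 := hx.quantile_ucb_le hgrp hα h1
  have h5 := hx.le_quantile_lcb hgrp hα hb
  unfold groupGap; linarith

lemma AllConcentrate.abs_sub_quantile_le (hgrp : Function.Surjective grp)
    (hα : α ∈ Set.Ioo (0 : ℝ) 1) (hx : AllConcentrate δ μ x) {k : ℕ} {j : A}
    (hj : (seRun grp α δ x (k + 1)).IsActive j) :
    |μ j - groupQuantile grp α μ (grp j)| ≤ 4 * roundWidth A δ (k + 1) := by
  have hk := seRun_isActive_of_succ hj
  have hc := ((seRun_isActive_iff k j).1 hk).1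
  obtain ⟨-, h1, h2⟩ := (seRun_pot_succ k _ j).1 ((seRun_isActive_iff _ j).1 hj).2
  have h3 := hx.quantile_ucb_le hgrp hα hc
  have h4 := hx.le_quantile_lcb hgrp hα hc
  have h5 := hx.le_lcb_of_active hk
  have h6 := hx.ucb_le_of_active hk
  rw [abs_le]; constructor <;> linarith

/-- While the algorithm runs, the target precision is below the confidence width. -/
lemma AllConcentrate.le_of_running (hgrp : Function.Surjective grp)
    (hα : α ∈ Set.Ioo (0 : ℝ) 1) (hx : AllConcentrate δ μ x) {Δ : ℝ} {hs : H}
    (hbest : IsBest grp α μ hs) {k : ℕ} (hrun : ¬ (seRun grp α δ x (k + 1)).Stop Δ) :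
    Δ ≤ 4 * roundWidth A δ (k + 1) := by
  unfold SEState.Stop at hrun
  rw [not_or, seRun_gap_succ, EReal.coe_le_coe_iff] at hrun
  refine (not_le.1 hrun.2).le.trans ?_
  have hb' := hx.best_mem_cand hgrp hα hbest (k + 1)
  have hR : sSup (groupQuantile grp α ((seRun grp α δ x (k + 1)).ucb δ) ''
      (seRun grp α δ x (k + 1)).cand)
      ≤ groupQuantile grp α μ hs + 2 * roundWidth A δ (k + 1) := by
    refine csSup_le ⟨_, hs, hb', rfl⟩ ?_
    rintro _ ⟨h, hh, rfl⟩
    have h1 := hx.quantile_ucb_le hgrp hα ((seRun_cand_succ k h).1 hh).1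
    linarith [hbest h]
  have hL : groupQuantile grp α ((seRun grp α δ x (k + 1)).lcb δ) hs
      ≤ sSup (groupQuantile grp α ((seRun grp α δ x (k + 1)).lcb δ) ''
        (seRun grp α δ x (k + 1)).cand) :=
    le_csSup (Set.toFinite _).bddAbove ⟨hs, hb', rfl⟩
  have h2 := hx.le_quantile_lcb hgrp hα (hx.best_mem_cand hgrp hα hbest k)
  unfold SEState.spread
  linarith

/-- While the loop runs, some candidate other than the best group survives, and its gap dominates
`Δ₀`. -/
lemma AllConcentrate.bestGap_le_of_running (hgrp : Function.Surjective grp)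
    (hα : α ∈ Set.Ioo (0 : ℝ) 1) (hx : AllConcentrate δ μ x) {Δ : ℝ} {hs : H}
    (hbest : IsBest grp α μ hs) {k : ℕ} (hrun : ¬ (seRun grp α δ x (k + 1)).Stop Δ) :
    bestGap grp α μ hs ≤ 4 * roundWidth A δ (k + 1) := by
  have hcard : 1 < (seRun grp α δ x (k + 1)).cand.card := not_le.1 fun h => hrun (Or.inl h)
  obtain ⟨h, hh, hne⟩ := Finset.exists_mem_ne hcard hs
  exact (bestGap_le_groupGap α μ hne).trans (hx.groupGap_le hgrp hα hbest hh)

/-- An arm that is active while the algorithm runs has a gap below the confidence width. -/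
lemma AllConcentrate.armGap_le (hgrp : Function.Surjective grp)
    (hα : α ∈ Set.Ioo (0 : ℝ) 1) (hx : AllConcentrate δ μ x) {Δ : ℝ} {hs : H}
    (hbest : IsBest grp α μ hs) {k : ℕ} (hrun : ¬ (seRun grp α δ x (k + 1)).Stop Δ) {j : A}
    (hj : (seRun grp α δ x (k + 1)).IsActive j) :
    armGap grp α Δ μ hs j ≤ 4 * roundWidth A δ (k + 1) :=
  max_le (max_le (hx.le_of_running hgrp hα hbest hrun)
      (hx.groupGap_le hgrp hα hbest ((seRun_isActive_iff _ j).1 hj).1))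
    (max_le (hx.bestGap_le_of_running hgrp hα hbest hrun) (hx.abs_sub_quantile_le hgrp hα hj))

/-- Every possible output is near-optimal. -/
lemma AllConcentrate.isNearBest_of_isOutput (hgrp : Function.Surjective grp)
    (hα : α ∈ Set.Ioo (0 : ℝ) 1) [Nonempty H]
    (hx : AllConcentrate δ μ x) {Δ : ℝ} (hΔ : 0 ≤ Δ) {k : ℕ} (hrun : (seRun grp α δ x k).Stop Δ) {h : H}
    (hout : (seRun grp α δ x k).IsOutput grp α δ h) : IsNearBest grp α Δ μ h := by
  obtain ⟨hs, hbest⟩ := Finite.exists_max (groupQuantile grp α μ)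
  have hb := hx.best_mem_cand hgrp hα hbest k
  intro h'
  refine (sub_le_sub_right (hbest h') Δ).trans ?_
  rcases hrun with hcard | hgap
  · rw [Finset.card_le_one.1 hcard _ hb _ hout.1]; linarith
  · cases k with
    -- The initial gap is `⊤`, so before any round only the cardinality condition can stop the loop.
    | zero => exact absurd hgap (not_le.2 (EReal.coe_lt_top Δ))
    | succ k =>
      -- The chain is: best quantile, its upper bound, the largest upper bound, the largest lower
      -- bound plus `Δ`, attained by the output, whose lower bound is below its quantile.
      rw [seRun_gap_succ, EReal.coe_le_coe_iff, SEState.spread] at hgap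
      have hR : groupQuantile grp α ((seRun grp α δ x (k + 1)).ucb δ) hs
          ≤ sSup (groupQuantile grp α ((seRun grp α δ x (k + 1)).ucb δ) ''
            (seRun grp α δ x (k + 1)).cand) :=
        le_csSup (Set.toFinite _).bddAbove ⟨hs, hb, rfl⟩
      have hL : sSup (groupQuantile grp α ((seRun grp α δ x (k + 1)).lcb δ) ''
            (seRun grp α δ x (k + 1)).cand)
          ≤ groupQuantile grp α ((seRun grp α δ x (k + 1)).lcb δ) h := by
        refine csSup_le ⟨_, hs, hb, rfl⟩ ?_
        rintro _ ⟨g, hg, rfl⟩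
        exact hout.2 g hg
      have h1 := hx.quantile_lcb_le hgrp hα k h
      have h2 := hx.le_quantile_ucb hgrp hα k hs
      linarith

end Run

/-! ### The number of pulls -/

section Inversion

lemma log_two_le_log {y : ℝ} (hy : 2 ≤ y) : 0.69 ≤ Real.log y :=
  (by linarith [Real.log_two_gt_d9] : (0.69 : ℝ) ≤ Real.log 2).trans
    (Real.log_le_log two_pos hy)

lemma one_le_log_exp_div_sq {D : ℝ} (hD : 0 < D) (hD1 : D ≤ 1) :
    1 ≤ Real.log (Real.exp 1 / D ^ 2) := by
  rw [Real.le_log_iff_exp_le (by positivity), le_div_iff₀ (by positivity)]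
  nlinarith [Real.exp_pos 1, pow_le_one₀ hD.le hD1 (n := 2)]

lemma log_mul_log_exp_div_sq {y D : ℝ} (hy : 0 < y) (hD : 0 < D) (hD1 : D ≤ 1) :
    Real.log (y * Real.log (Real.exp 1 / D ^ 2))
      = Real.log y + Real.log (Real.log (Real.exp 1 / D ^ 2)) :=
  Real.log_mul hy.ne' (by linarith [one_le_log_exp_div_sq hD hD1])

/-- The capped level satisfies `1/η = max (n/δ) 10 ≤ (n/δ)⁴`, because `2⁴ > 10`. -/
lemma log_one_div_min_le {n δ : ℝ} (hn : 2 ≤ n / δ) :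
    Real.log (1 / min (δ / n) (1 / 10)) ≤ 4 * Real.log (n / δ) ∧
      1 ≤ Real.log (1 / min (δ / n) (1 / 10)) := by
  have hpos : 0 < n / δ := by linarith
  have h1 : δ / n = (n / δ)⁻¹ := (inv_div n δ).symm
  have hmin : 1 / min (δ / n) (1 / 10) = max (n / δ) 10 := by
    rw [h1, one_div, one_div]
    rcases le_total (n / δ) 10 with h | h
    · rw [min_eq_right (inv_anti₀ hpos h), inv_inv, max_eq_right h]
    · rw [min_eq_left (inv_anti₀ (by norm_num) h), inv_inv, max_eq_left h]
  rw [hmin]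
  constructor
  · have h4 : 4 * Real.log (n / δ) = Real.log ((n / δ) ^ 4) := by
      rw [Real.log_pow]; norm_num
    rw [h4]
    refine Real.log_le_log (lt_of_lt_of_le hpos (le_max_left _ _)) (max_le ?_ ?_)
    · exact le_self_pow₀ (by linarith) (by norm_num)
    · have := pow_le_pow_left₀ (by norm_num) hn 4
      linarith
  · have := log_ten_ge.trans (Real.log_le_log (by norm_num) (le_max_right (n / δ) 10))
    linarith

/-- Inversion of the confidence width. -/
lemma succ_le_of_le_confWidth {n δ D : ℝ} (hn : 2 ≤ n / δ) (hD : 0 < D) (hD1 : D ≤ 1) {T : ℕ}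
    (hT : 1 ≤ T) (h : D ≤ 4 * confWidth T (min (δ / n) (1 / 10))) :
    (T : ℝ) + 1 ≤ 2000 / D ^ 2 * Real.log (n / δ * Real.log (Real.exp 1 / D ^ 2)) := by
  rw [log_mul_log_exp_div_sq (by linarith) hD hD1]
  obtain ⟨hη1, hη2⟩ := log_one_div_min_le hn
  set Lη := Real.log (1 / min (δ / n) (1 / 10)) with hLη
  set L := Real.log (n / δ) with hL
  have hL0 : 0.69 ≤ L := log_two_le_log hn
  set l := Real.log (Real.exp 1 / D ^ 2) with hl
  have hl1 : 1 ≤ l := one_le_log_exp_div_sq hD hD1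
  have hll : 0 ≤ Real.log l := Real.log_nonneg hl1
  have hT1 : (1 : ℝ) ≤ T := by exact_mod_cast hT
  have hT0 : (0 : ℝ) < T := by linarith
  have hlT : Real.log (Real.exp 1 * T) = 1 + Real.log T := by
    rw [Real.log_mul (Real.exp_pos 1).ne' hT0.ne', Real.log_exp]
  have hlT0 : 0 ≤ Real.log T := Real.log_nonneg hT1
  have hD2 : 0 < D ^ 2 := by positivity
  have hD21 : D ^ 2 ≤ 1 := pow_le_one₀ hD.le hD1
  have hlogη : Real.log Lη ≤ Lη := (Real.log_le_sub_one_of_pos (by linarith)).trans (by linarith)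
  have hlogη0 : 0 ≤ Real.log Lη := Real.log_nonneg hη2
  have hlog1T : 0 ≤ Real.log (1 + Real.log T) := Real.log_nonneg (by linarith)
  -- The factor 8 is `2 + 6`, after `log Lη ≤ Lη`.
  have hsq : D ^ 2 * T ≤ 16 * (8 * Lη + 3 * Real.log (1 + Real.log T)) := by
    rw [confWidth, ← hLη, hlT] at h
    have h2 := pow_le_pow_left₀ hD.le h 2
    rw [mul_pow, Real.sq_sqrt (by positivity)] at h2
    have h3 := mul_le_mul_of_nonneg_right h2 hT0.le
    rw [mul_assoc, div_mul_cancel₀ _ hT0.ne'] at h3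
    linarith
  set Z := D ^ 2 * T with hZ
  have hZ0 : 0 < Z := by positivity
  have hmain : Z + 1 ≤ 2000 * (L + Real.log l) := by
    rcases le_or_gt Z 1 with hZ1 | hZ1
    · linarith
    · have hlogZ : Real.log Z = Real.log (D ^ 2) + Real.log T := Real.log_mul hD2.ne' hT0.ne'
      have hl' : l = 1 - Real.log (D ^ 2) := by
        rw [hl, Real.log_div (Real.exp_pos 1).ne' hD2.ne', Real.log_exp]
      have hlogZ0 : 0 ≤ Real.log Z := Real.log_nonneg hZ1.le
      -- In terms of `Z = D² T` one has `1 + log T = l + log Z`, which is at most `l Z` as `l` and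
      -- `Z` are at least 1.
      have h1 : 1 + Real.log T ≤ l * Z := by
        have : Real.log Z ≤ Z - 1 := Real.log_le_sub_one_of_pos hZ0
        nlinarith
      have h2 : Real.log (1 + Real.log T) ≤ Real.log l + Real.log Z := by
        rw [← Real.log_mul (by linarith) hZ0.ne']
        exact Real.log_le_log (by linarith) h1
      -- Tangent of `log` at 96, chosen so that the contribution `48 log Z` is absorbed by `Z / 2`
      -- up to a constant.
      have h3 : Real.log Z ≤ Z / 96 + 4 := by
        have h4 := Real.log_le_sub_one_of_pos (by positivity : 0 < Z / 96)
        rw [Real.log_div hZ0.ne' (by norm_num)] at h4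
        have h5 : Real.log 96 ≤ 5 := by
          rw [Real.log_le_iff_le_exp (by norm_num)]
          have : Real.exp 5 = Real.exp 1 ^ 5 := by rw [← Real.exp_nat_mul]; norm_num
          rw [this]
          exact le_trans (by norm_num)
            (pow_le_pow_left₀ (by norm_num) Real.exp_one_gt_d9.le 5)
        linarith
      nlinarith
  have hTD : (T : ℝ) + 1 ≤ (Z + 1) / D ^ 2 := by
    rw [le_div_iff₀ hD2, hZ]; nlinarith
  refine hTD.trans ?_
  rw [div_mul_eq_mul_div]
  gcongr

end Inversion

/-! ### Termination and pull counts on concentrated rewards -/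

section Success

variable {A H : Type*} [Fintype A] [Fintype H] {grp : A → H} {α Δ δ : ℝ}
  {x : A → ℕ → ℝ} {μ : A → ℝ}

/-- If the loop is entered there are at least two groups, hence two arms; this keeps `log (n/δ)`
away from 0. -/
lemma two_le_card_div_of_running (hgrp : Function.Surjective grp) (hδ : δ ∈ Set.Ioo (0 : ℝ) 1)
    (h : ¬ (seRun grp α δ x 0).Stop Δ) : 2 ≤ (Fintype.card A : ℝ) / δ := by
  have h1 : 1 < Fintype.card H := not_le.1 fun hle => h (Or.inl hle)
  have h2 : (2 : ℝ) ≤ Fintype.card A := by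
    exact_mod_cast h1.trans_le (Fintype.card_le_of_surjective grp hgrp)
  rw [le_div_iff₀ hδ.1]
  linarith [hδ.2]

/-- The bound on the number of pulls of arm `j`. -/
lemma AllConcentrate.count_le (hgrp : Function.Surjective grp) (hα : α ∈ Set.Ioo (0 : ℝ) 1)
    (hΔ : Δ ∈ Set.Ioo (0 : ℝ) 1) (hδ : δ ∈ Set.Ioo (0 : ℝ) 1)
    (hμ : ∀ j, μ j ∈ Set.Icc (0 : ℝ) 1) (hx : AllConcentrate δ μ x) {hs : H}
    (hbest : IsBest grp α μ hs) {k : ℕ} (hk : ∀ i < k, ¬ (seRun grp α δ x i).Stop Δ) (j : A) :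
    ((seRun grp α δ x k).count j : ℝ) ≤ 2000 / armGap grp α Δ μ hs j ^ 2 *
      Real.log (Fintype.card A / δ * Real.log (Real.exp 1 / armGap grp α Δ μ hs j ^ 2)) := by
  have hD : 0 < armGap grp α Δ μ hs j := hΔ.1.trans_le (le_armGap α Δ μ hs j)
  have hD1 := armGap_le_one hgrp hα hΔ.2.le hμ hs j
  have hl := one_le_log_exp_div_sq hD hD1
  have hA : (1 : ℝ) ≤ Fintype.card A := by
    exact_mod_cast Fintype.card_pos_iff.2 ⟨j⟩
  rcases seRun_count_eq_zero_or_active (grp := grp) (α := α) (δ := δ) (x := x) k j with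
    h0 | ⟨t, htk, hct, hact⟩
  · rw [h0, Nat.cast_zero]
    have h1 : 1 ≤ Fintype.card A / δ := by rw [le_div_iff₀ hδ.1]; linarith [hδ.2]
    have : 0 ≤ Real.log (Fintype.card A / δ *
        Real.log (Real.exp 1 / armGap grp α Δ μ hs j ^ 2)) := Real.log_nonneg (by nlinarith)
    positivity
  · have hn := two_le_card_div_of_running hgrp hδ (hk 0 (by omega))
    rw [hct]
    cases t with
    -- A single pull, made before any interval exists: the bound is at least `2000 * 0.69`.
    | zero =>
      rw [log_mul_log_exp_div_sq (by linarith) hD hD1]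
      have h1 : 2000 ≤ 2000 / armGap grp α Δ μ hs j ^ 2 := by
        rw [le_div_iff₀ (by positivity)]
        nlinarith [pow_le_one₀ hD.le hD1 (n := 2)]
      have h2 := log_two_le_log hn
      have h3 := Real.log_nonneg hl
      push_cast
      nlinarith
    | succ t =>
      -- The arm was active after `t + 1` rounds and pulled once more, hence the `+ 1` in the
      -- inversion.
      have := succ_le_of_le_confWidth hn hD hD1 (Nat.succ_le_succ (Nat.zero_le t))
        (hx.armGap_le hgrp hα hbest (hk _ htk) hact)
      rw [Nat.cast_succ]
      exact this

variable [Nonempty H]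

/-- An endless run would keep `Δ` below four times a width that tends to 0. -/
lemma AllConcentrate.exists_stopsAt (hgrp : Function.Surjective grp) (hα : α ∈ Set.Ioo (0 : ℝ) 1)
    (hΔ : Δ ∈ Set.Ioo (0 : ℝ) 1) (hδ : δ ∈ Set.Ioo (0 : ℝ) 1) (hx : AllConcentrate δ μ x) :
    ∃ k, StopsAt grp α Δ δ x k := by
  classical
  obtain ⟨hs, hbest⟩ := Finite.exists_max (groupQuantile grp α μ)
  have hex : ∃ k, (seRun grp α δ x k).Stop Δ := by
    by_contra! hcon
    have hn := two_le_card_div_of_running hgrp hδ (hcon 0)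
    obtain ⟨T, hT⟩ := exists_nat_gt
      (2000 / Δ ^ 2 * Real.log (Fintype.card A / δ * Real.log (Real.exp 1 / Δ ^ 2)))
    have h := succ_le_of_le_confWidth hn hΔ.1 hΔ.2.le (Nat.succ_le_succ (Nat.zero_le T))
      (hx.le_of_running hgrp hα hbest (hcon (T + 1)))
    push_cast at h
    linarith
  exact ⟨Nat.find hex, Nat.find_spec hex, fun i hi => Nat.find_min hex hi⟩

/-- On concentrated rewards, successive elimination succeeds. -/
theorem AllConcentrate.seSucceeds (hgrp : Function.Surjective grp) (hα : α ∈ Set.Ioo (0 : ℝ) 1)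
    (hΔ : Δ ∈ Set.Ioo (0 : ℝ) 1) (hδ : δ ∈ Set.Ioo (0 : ℝ) 1)
    (hμ : ∀ j, μ j ∈ Set.Icc (0 : ℝ) 1) (hx : AllConcentrate δ μ x) :
    SESucceeds grp α Δ δ μ x (fun T => ∀ hs, IsBest grp α μ hs →
      (T : ℝ) ≤ pullBound 2000 grp α Δ δ μ hs) := by
  obtain ⟨k, hk⟩ := hx.exists_stopsAt hgrp hα hΔ hδ
  refine ⟨k, hk, fun h hout => hx.isNearBest_of_isOutput hgrp hα hΔ.1.le hk.1 hout,
    fun hs hbest => ?_⟩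
  rw [SEState.pulls, Nat.cast_sum]
  exact Finset.sum_le_sum fun j _ => hx.count_le hgrp hα hΔ hδ hμ hbest hk.2 j

end Success

/-! ### The bound for sampled groups -/

section Sampled

lemma numArms_pos {g : ℕ} (hg : 1 ≤ g) {ε δ : ℝ} (hε : 0 < ε) (hδ : 0 < δ) (hδ1 : δ ≤ 1) :
    0 < numArms g ε δ := by
  rw [numArms, Nat.ceil_pos]
  have hg' : (1 : ℝ) ≤ g := by exact_mod_cast hg
  have : 0 < Real.log (2 * g / δ) := Real.log_pos (by rw [lt_div_iff₀ hδ]; linarith)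
  positivity

/-- The `+ 1` of the ceiling is absorbed because `1/ε² ≥ 4` and `log (g/δ) ≥ 0.69`. -/
lemma numArms_le {g : ℕ} (hg : 1 ≤ g) {ε δ : ℝ} (hε : 0 < ε) (hε2 : ε ≤ 1 / 2) (hδ : 0 < δ)
    (hδε : δ ≤ ε) : (numArms g ε δ : ℝ) ≤ 2 / ε ^ 2 * Real.log (g / δ) := by
  have hg' : (1 : ℝ) ≤ g := by exact_mod_cast hg
  have h2 : 2 ≤ (g : ℝ) / δ := by rw [le_div_iff₀ hδ]; linarith
  have hL := log_two_le_log h2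
  have hlog : Real.log (2 * g / δ) ≤ 2 * Real.log (g / δ) := by
    rw [mul_div_assoc, Real.log_mul two_ne_zero (by linarith)]
    linarith [Real.log_le_log two_pos h2]
  have hlog0 : 0 ≤ Real.log (2 * g / δ) := Real.log_nonneg (by rw [mul_div_assoc]; linarith)
  have hceil := (Nat.ceil_lt_add_one (by positivity :
    0 ≤ 1 / (2 * ε ^ 2) * Real.log (2 * g / δ))).le
  refine hceil.trans ?_
  have hε4 : 4 ≤ 1 / ε ^ 2 := by
    rw [le_div_iff₀ (by positivity)]
    nlinarith [pow_le_pow_left₀ hε.le hε2 2]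
  have e1 : 1 / (2 * ε ^ 2) = 1 / ε ^ 2 / 2 := by field_simp
  have e2 : 2 / ε ^ 2 = 2 * (1 / ε ^ 2) := by ring
  rw [e1, e2]
  have h3 : 1 / ε ^ 2 / 2 * Real.log (2 * g / δ) ≤ 1 / ε ^ 2 / 2 * (2 * Real.log (g / δ)) := by
    gcongr
  nlinarith

lemma pull_term_antitone {y D D' : ℝ} (hy : 1 ≤ y) (hD : 0 < D) (hDD : D ≤ D') (hD' : D' ≤ 1) :
    2000 / D' ^ 2 * Real.log (y * Real.log (Real.exp 1 / D' ^ 2))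
      ≤ 2000 / D ^ 2 * Real.log (y * Real.log (Real.exp 1 / D ^ 2)) := by
  have hl := one_le_log_exp_div_sq (hD.trans_le hDD) hD'
  have h0 : 0 ≤ Real.log (y * Real.log (Real.exp 1 / D' ^ 2)) := Real.log_nonneg (by nlinarith)
  have hD0 := hD.trans_le hDD
  gcongr

/-- The instance-dependent bound for groups of sampled arms, in terms of the parameters only. -/
lemma pullBound_sampled_le {G : Type*} [Fintype G] [Nonempty G] {α ε Δ δ : ℝ}
    (hα : α ∈ Set.Ioo (0 : ℝ) 1) (hΔ : Δ ∈ Set.Ioo (0 : ℝ) 1) (hδ : 0 < δ) (hδε : δ < ε)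
    (hε : ε < min α (1 - α)) {μ : G × Fin (numArms (Fintype.card G) ε δ) → ℝ}
    (hμ : ∀ j, μ j ∈ Set.Icc (0 : ℝ) 1) (hs : G) :
    pullBound 2000 Prod.fst α Δ δ μ hs ≤ 40000 * (Fintype.card G / (ε ^ 2 * Δ ^ 2)) *
      (Real.log (Fintype.card G / δ) ^ 2 + Real.log (Fintype.card G / δ) *
        Real.log (Real.log (Real.exp 1 / Δ))) := by
  have hε0 : 0 < ε := hδ.trans hδε
  have hε2 : ε ≤ 1 / 2 := by
    have h1 := hε.trans_le (min_le_left _ _)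
    have h2 := hε.trans_le (min_le_right _ _)
    linarith
  have hcard : 1 ≤ Fintype.card G := Fintype.card_pos
  have hg : (1 : ℝ) ≤ Fintype.card G := by exact_mod_cast hcard
  have hNpos := numArms_pos hcard hε0 hδ (by linarith)
  have hNle := numArms_le hcard hε0 hε2 hδ hδε.le
  have hn : (Fintype.card (G × Fin (numArms (Fintype.card G) ε δ)) : ℝ)
      = Fintype.card G * numArms (Fintype.card G) ε δ := by
    rw [Fintype.card_prod, Fintype.card_fin, Nat.cast_mul]
  unfold pullBound
  rw [hn]
  set N : ℝ := ((numArms (Fintype.card G) ε δ : ℕ) : ℝ) with hN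
  set g : ℝ := ((Fintype.card G : ℕ) : ℝ) with hgdef
  have hN1 : 1 ≤ N := by rw [hN]; exact_mod_cast hNpos
  have hsurj : Function.Surjective
      (Prod.fst : G × Fin (numArms (Fintype.card G) ε δ) → G) :=
    fun a => ⟨(a, ⟨0, hNpos⟩), rfl⟩
  have h2 : 2 ≤ g / δ := by rw [le_div_iff₀ hδ]; linarith
  set L := Real.log (g / δ) with hL
  have hL0 : 0.69 ≤ L := log_two_le_log h2
  have hy : g * N / δ = g / δ * N := by ring
  have hy1 : 1 ≤ g * N / δ := by rw [hy]; nlinarith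
  have hl1 : 1 ≤ Real.log (Real.exp 1 / Δ) := by
    rw [Real.le_log_iff_exp_le (div_pos (Real.exp_pos 1) hΔ.1), le_div_iff₀ hΔ.1]
    nlinarith [Real.exp_pos 1, hΔ.2]
  set l := Real.log (Real.exp 1 / Δ) with hl
  have hll : 0 ≤ Real.log l := Real.log_nonneg hl1
  -- As `δ < ε`, `1/ε ≤ g/δ`, so `log N ≤ log 2 + 2 log (1/ε) + log L` is of order `L`.
  have hlogN : Real.log N ≤ 5 * L := by
    have hεL : -Real.log ε ≤ L := by
      rw [← Real.log_inv]
      refine Real.log_le_log (inv_pos.2 hε0) ?_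
      rw [inv_eq_one_div]
      exact div_le_div₀ (by linarith) hg hδ hδε.le
    have h3 := Real.log_le_log (by linarith) hNle
    rw [Real.log_mul (by positivity) (by linarith), Real.log_div two_ne_zero (by positivity),
      Real.log_pow] at h3
    have h4 := Real.log_le_sub_one_of_pos (by linarith : 0 < L)
    have h5 := Real.log_le_log two_pos h2
    push_cast at h3
    linarith
  have hlogΔ : Real.log (Real.log (Real.exp 1 / Δ ^ 2)) ≤ L + Real.log l := by
    have e : Real.log (Real.exp 1 / Δ ^ 2) ≤ 2 * l := by
      rw [hl, Real.log_div (Real.exp_pos 1).ne' (by have := hΔ.1; positivity),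
        Real.log_div (Real.exp_pos 1).ne' hΔ.1.ne', Real.log_exp, Real.log_pow]
      push_cast; linarith
    have h3 := Real.log_le_log (by linarith [one_le_log_exp_div_sq hΔ.1 hΔ.2.le]) e
    rw [Real.log_mul two_ne_zero (by linarith)] at h3
    linarith [Real.log_le_log two_pos h2]
  -- Each gap is replaced by `Δ`; the 7 collects `L` from `g/δ`, `5 L` from `N` and `L` from the
  -- iterated logarithm.
  have hterm : ∀ j, 2000 / armGap Prod.fst α Δ μ hs j ^ 2 * Real.log (g * N / δ *
      Real.log (Real.exp 1 / armGap Prod.fst α Δ μ hs j ^ 2))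
      ≤ 2000 / Δ ^ 2 * (7 * L + Real.log l) := by
    intro j
    refine (pull_term_antitone hy1 hΔ.1 (le_armGap α Δ μ hs j)
      (armGap_le_one hsurj hα hΔ.2.le hμ hs j)).trans ?_
    rw [log_mul_log_exp_div_sq (by linarith) hΔ.1 hΔ.2.le, hy,
      Real.log_mul (by linarith) (by linarith)]
    refine mul_le_mul_of_nonneg_left (by linarith) (by positivity)
  refine (Finset.sum_le_sum fun j _ => hterm j).trans ?_
  rw [Finset.sum_const, Finset.card_univ, nsmul_eq_mul, hn]
  have hΔ0 := hΔ.1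
  calc g * N * (2000 / Δ ^ 2 * (7 * L + Real.log l))
      ≤ g * (2 / ε ^ 2 * L) * (2000 / Δ ^ 2 * (7 * L + Real.log l)) := by gcongr
    _ = 4000 * (g / (ε ^ 2 * Δ ^ 2)) * (7 * L ^ 2 + L * Real.log l) := by field_simp; ring
    _ ≤ 4000 * (g / (ε ^ 2 * Δ ^ 2)) * (10 * (L ^ 2 + L * Real.log l)) := by
        have : 0 ≤ L * Real.log l := by positivity
        gcongr
        nlinarith [sq_nonneg L]
    _ = _ := by ring

end Sampled

/-! ### The probability of concentration -/

section Probability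

variable {A : Type*} [Fintype A]

/-- With probability at least `1 - δ`, the rewards of all arms concentrate. -/
lemma measure_not_allConcentrate_le [Nonempty A] {δ : ℝ} (hδ : 0 < δ) {Ω : Type*}
    [MeasurableSpace Ω] {P : Measure Ω} [IsProbabilityMeasure P] {μ : A → ℝ} {ν : A → Measure ℝ}
    (hν : ∀ j, IsRewardLaw (ν j) (μ j)) {X : A → ℕ → Ω → ℝ} (hX : ∀ j t, HasLaw (X j t) (ν j) P)
    (hind : ∀ j, iIndepFun (X j) P) :
    P {ω | ¬ AllConcentrate δ μ (fun j t => X j t ω)} ≤ ENNReal.ofReal δ := by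
  have hn : (0 : ℝ) < Fintype.card A := by exact_mod_cast Fintype.card_pos
  set η := min (δ / Fintype.card A) (1 / 10) with hη
  have hη0 : 0 < η := lt_min (by positivity) (by norm_num)
  have hsub : {ω | ¬ AllConcentrate δ μ (fun j t => X j t ω)}
      ⊆ ⋃ j, {ω | ¬ Concentrates η (μ j) (fun t => X j t ω)} := by
    intro ω hω
    obtain ⟨j, hj⟩ := not_forall.1 hω
    exact Set.mem_iUnion.2 ⟨j, hj⟩
  refine (measure_mono hsub).trans ((measure_iUnion_fintype_le _ _).trans ?_)
  refine (Finset.sum_le_sum fun j _ =>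
    measure_not_concentrates_le (hν j) (hX j) (hind j) hη0 (min_le_right _ _)).trans ?_
  rw [← ENNReal.ofReal_sum_of_nonneg fun _ _ => hη0.le]
  refine ENNReal.ofReal_le_ofReal ?_
  rw [Finset.sum_const, Finset.card_univ, nsmul_eq_mul, mul_comm, ← le_div_iff₀ hn]
  exact min_le_left _ _

lemma measurableSet_allConcentrate (δ : ℝ) :
    MeasurableSet {p : (A → ℝ) × (A × ℕ → ℝ) | AllConcentrate δ p.1 (fun j t => p.2 (j, t))} := by
  simp only [AllConcentrate, Set.ofPred_forall]
  refine MeasurableSet.iInter fun j => ?_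
  have hφ : Measurable fun p : (A → ℝ) × (A × ℕ → ℝ) => (p.1 j, fun t : ℕ => p.2 (j, t)) := by
    fun_prop
  exact hφ (measurableSet_concentrates _)

/-- Concentration for arms whose means are sampled. -/
lemma armLaw_not_allConcentrate_le [Nonempty A] {δ : ℝ} (hδ : 0 < δ) (ρ : A → Measure ℝ)
    [∀ j, IsProbabilityMeasure (ρ j)] (κ : Kernel ℝ ℝ) [IsMarkovKernel κ]
    (hρ : ∀ j, ∀ᵐ m ∂(ρ j), IsRewardLaw (κ m) m) :
    armLaw ρ κ {p | ¬ (AllConcentrate δ p.1 (fun j t => p.2 (j, t)) ∧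
      ∀ j, p.1 j ∈ Set.Icc (0 : ℝ) 1)} ≤ ENNReal.ofReal δ := by
  have hmeas : MeasurableSet {p : (A → ℝ) × (A × ℕ → ℝ) |
      AllConcentrate δ p.1 (fun j t => p.2 (j, t)) ∧ ∀ j, p.1 j ∈ Set.Icc (0 : ℝ) 1} := by
    have h : MeasurableSet {p : (A → ℝ) × (A × ℕ → ℝ) | ∀ j, p.1 j ∈ Set.Icc (0 : ℝ) 1} := by
      simp only [Set.ofPred_forall]
      exact MeasurableSet.iInter fun j =>
        ((measurable_pi_apply j).comp measurable_fst) measurableSet_Icc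
    exact (measurableSet_allConcentrate δ).inter h
  -- For almost every draw of the means the fixed-means estimate applies; its bound is then
  -- integrated over the means.
  have hae : ∀ᵐ m ∂(Measure.pi ρ), ∀ j, IsRewardLaw (κ (m j)) (m j) :=
    ae_all_iff.2 fun j => (measurePreserving_eval ρ j).quasiMeasurePreserving.ae (hρ j)
  refine (Measure.compProd_apply hmeas.compl).trans_le ?_
  calc _ ≤ ∫⁻ _, ENNReal.ofReal δ ∂(Measure.pi ρ) := by
        refine lintegral_mono_ae (hae.mono fun m hm => ?_)
        refine (measure_mono (t := {y : A × ℕ → ℝ |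
          ¬ AllConcentrate δ m (fun j t => y (j, t))}) ?_).trans ?_
        · intro y hy hc
          exact hy ⟨hc, fun j => (hm j).mean_mem⟩
        · have hlaw : ∀ j t, HasLaw (fun y : A × ℕ → ℝ => y (j, t)) (κ (m j))
              (Measure.infinitePi fun p : A × ℕ => κ (m p.1)) := fun j t =>
            (measurePreserving_eval_infinitePi (fun p : A × ℕ => κ (m p.1)) (j, t)).hasLaw
          have hind : iIndepFun (fun (p : A × ℕ) (y : A × ℕ → ℝ) => y p)
              (Measure.infinitePi fun p : A × ℕ => κ (m p.1)) :=
            iIndepFun_infinitePi (P := fun p : A × ℕ => κ (m p.1)) (X := fun _ x => x)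
              fun _ => measurable_id
          exact measure_not_allConcentrate_le hδ hm hlaw fun j =>
            hind.precomp (g := fun t : ℕ => (j, t)) fun _ _ h => (Prod.mk.inj h).2
    _ = ENNReal.ofReal δ := by simp

lemma SESucceeds.mono {H : Type*} [Fintype H] {grp : A → H} {α Δ δ : ℝ} {μ : A → ℝ}
    {x : A → ℕ → ℝ} {B B' : ℕ → Prop} (h : SESucceeds grp α Δ δ μ x B) (hB : ∀ T, B T → B' T) :
    SESucceeds grp α Δ δ μ x B' := by
  obtain ⟨k, h1, h2, h3⟩ := h
  exact ⟨k, h1, h2, hB _ h3⟩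

end Probability

end GroupedBandit

/-! ### Fixed arms and sampled arms -/

open GroupedBandit

theorem mainTheorem2 :
    ∃ c d : ℝ, 0 < c ∧ 0 < d ∧
      -- finite-arm problem
      (∀ (A : Type u) (H : Type v) [Fintype A] [Fintype H] [Nonempty H]
        (grp : A → H) (_ : Function.Surjective grp)
        (α Δ δ : ℝ) (_ : α ∈ Set.Ioo (0 : ℝ) 1) (_ : Δ ∈ Set.Ioo (0 : ℝ) 1)
        (_ : δ ∈ Set.Ioo (0 : ℝ) 1)
        (Ω : Type w) [MeasurableSpace Ω] (P : Measure Ω) [IsProbabilityMeasure P]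
        (μ : A → ℝ) (ν : A → Measure ℝ) (_ : ∀ j, GroupedBandit.IsRewardLaw (ν j) (μ j))
        (X : A → ℕ → Ω → ℝ) (_ : ∀ j t, HasLaw (X j t) (ν j) P) (_ : ∀ j, iIndepFun (X j) P),
        P {ω | ¬ GroupedBandit.SESucceeds grp α Δ δ μ (fun j t => X j t ω) (fun T =>
            ∀ hs, GroupedBandit.IsBest grp α μ hs →
              (T : ℝ) ≤ GroupedBandit.pullBound c grp α Δ δ μ hs)}
          ≤ ENNReal.ofReal δ) ∧
      -- groups of arms sampled from the reservoir distributions `F g`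
      (∀ (G : Type v) [Fintype G] [Nonempty G]
        (α ε Δ δ : ℝ) (_ : α ∈ Set.Ioo (0 : ℝ) 1) (_ : Δ ∈ Set.Ioo (0 : ℝ) 1)
        (_ : 0 < δ) (_ : δ < ε) (_ : ε < min α (1 - α))
        (F : G → Measure ℝ) [∀ g, IsProbabilityMeasure (F g)]
        (κ : Kernel ℝ ℝ) [IsMarkovKernel κ]
        (_ : ∀ g, ∀ᵐ m ∂(F g), GroupedBandit.IsRewardLaw (κ m) m)
        (Ω : Type w) [MeasurableSpace Ω] (P : Measure Ω) [IsProbabilityMeasure P]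
        (M : G × Fin (GroupedBandit.numArms (Fintype.card G) ε δ) → Ω → ℝ)
        (X : G × Fin (GroupedBandit.numArms (Fintype.card G) ε δ) → ℕ → Ω → ℝ)
        (_ : HasLaw (fun ω => ((fun j => M j ω), (fun p : _ × ℕ => X p.1 p.2 ω)))
          (GroupedBandit.armLaw (fun j => F j.1) κ) P),
        P {ω | ¬ GroupedBandit.SESucceeds Prod.fst α Δ δ (fun j => M j ω) (fun j t => X j t ω)
            (fun T => ∀ hs, GroupedBandit.IsBest Prod.fst α (fun j => M j ω) hs →
              (T : ℝ) ≤ GroupedBandit.pullBound c Prod.fst α Δ δ (fun j => M j ω) hs ∧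
              GroupedBandit.pullBound c Prod.fst α Δ δ (fun j => M j ω) hs ≤
                d * (Fintype.card G / (ε ^ 2 * Δ ^ 2)) *
                  (Real.log (Fintype.card G / δ) ^ 2 + Real.log (Fintype.card G / δ) *
                    Real.log (Real.log (Real.exp 1 / Δ))))}
          ≤ ENNReal.ofReal δ) := by
  
  refine ⟨2000, 40000, by norm_num, by norm_num, ?_, ?_⟩
  · intro A H _ _ _ grp hgrp α Δ δ hα hΔ hδ Ω _ P _ μ ν hν X hX hind
    have : Nonempty A := hgrp.nonempty
    refine (measure_mono ?_).trans (measure_not_allConcentrate_le hδ.1 hν hX hind)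
    intro ω (hω : ¬ SESucceeds _ _ _ _ _ _ _) hc
    exact hω (AllConcentrate.seSucceeds hgrp hα hΔ hδ (fun j => (hν j).mean_mem) hc)
  · intro G _ _ α ε Δ δ hα hΔ hδ hδε hε F _ κ _ hF Ω _ P _ M X hlaw
    have hε1 : ε < 1 := (hε.trans_le (min_le_left _ _)).trans hα.2
    have hN := numArms_pos (Fintype.card_pos (α := G)) (hδ.trans hδε) hδ (hδε.trans hε1).le
    have hne : Nonempty (G × Fin (numArms (Fintype.card G) ε δ)) :=
      ⟨(Classical.arbitrary G, ⟨0, hN⟩)⟩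
    have hbound := armLaw_not_allConcentrate_le hδ
      (fun j : G × Fin (numArms (Fintype.card G) ε δ) => F j.1) κ (fun j => hF j.1)
    rw [← hlaw.map_eq] at hbound
    have hsurj : Function.Surjective
        (Prod.fst : G × Fin (numArms (Fintype.card G) ε δ) → G) :=
      fun a => ⟨(a, ⟨0, hN⟩), rfl⟩
    -- Failure is contained in the complement of the concentration event, so the success event
    -- itself need not be measurable.
    refine (measure_mono ?_).trans
      ((Measure.le_map_apply hlaw.aemeasurable _).trans hbound)
    intro ω (hω : ¬ SESucceeds _ _ _ _ _ _ _) hc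
    exact hω ((AllConcentrate.seSucceeds hsurj hα hΔ ⟨hδ, hδε.trans hε1⟩ hc.2 hc.1).mono
      fun T hT hs hbest => ⟨hT hs hbest, pullBound_sampled_le hα hΔ hδ hδε hε hc.2 hs⟩)
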